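/- Let $n\ge 1$ and write $\lambda$ for Lebesgue measure on $\mathbb{R}^n$. A martingale is a function $M:2^{<\omega}\to[0,\infty)$ on finite binary strings with $M(\sigma0)+M(\sigma1)=2M(\sigma)$ for all $\sigma$; it is computable if its values are computable reals uniformly in $\sigma$. A binary sequence $Z$ is computably random if no computable martingale is unbounded along the initial segments of $Z$, and a point $x\in\mathbb{R}^n$ is computably random if its binary expansion is, that is, the binary sequence obtained by interleaving the binary expansions of the fractional parts of $x_1,\dots,x_n$ (for dyadic coordinates the expansion ending in zeros is used). For a binary string $\sigma$ let $[\sigma]$ be the set of $x\in[0,1)^n$ whose binary expansion extends $\sigma$. For a martingale $M$, $\mu_M$ denotes the (unique, if it exists) Borel probability measure carried by $[0,1)^n$ such that $\mu_M([\sigma])=\lambda([\sigma])\,M(\sigma)$ for all $\sigma$ whose length is a multiple of $n$. **Lemma.** Suppose $z\in[0,1]^n$ is not computably random. Then there is a computable martingale $M$ for which $\mu_M$ exists and such that * (P1) $\mu_M$ is absolutely continuous with respect to $\lambda$, and the limit $D_\lambda\mu_M(z)=\lim_{r\to0^+}\mu_M(B_r(z))/\lambda(B_r(z))$, over Euclidean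 balls centred at $z$, does not exist (neither as a finite number nor as $\infty$); * (P2) there is a constant $C$ with $0<M(\sigma)<C$ for all $\sigma$. Moreover, $M$ can be chosen such that in addition the density of $\mu_M$ is bounded away from $0$ and $\infty$: there are constants $0<c\le C'<\infty$ with $c\le d\mu_M/d\lambda\le C'$ $\lambda$-almost everywhere on $[0,1]^n$. -/

import Mathlib

open MeasureTheory Filter Topology
open scoped NNReal ENNReal

namespace CompRand

/-- The initial segment of length `k` of an infinite binary sequence. -/
def initialSegment (Z : ℕ → Bool) (k : ℕ) : List Bool := (List.range k).map Z

/-- A martingale (betting strategy) on finite binary strings: a nonnegative real-valued function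
satisfying the fairness condition. -/
structure IsMartingale (d : List Bool → ℝ) : Prop where
  nonneg : ∀ σ, 0 ≤ d σ
  fair : ∀ σ, d (σ ++ [false]) + d (σ ++ [true]) = 2 * d σ

/-- A nonnegative real-valued function `d` on binary strings is computable if its values are
computable reals uniformly in the argument: from `σ` and `k` one can compute a dyadic rational
`a σ k / 2 ^ k` within `2 ^ (-k)` of `d σ`. As `d` is nonnegative, natural numerators suffice. -/
def IsComputableFun (d : List Bool → ℝ) : Prop :=
  ∃ a : List Bool → ℕ → ℕ, Computable₂ a ∧
    ∀ σ k, |d σ - (a σ k : ℝ) / 2 ^ k| ≤ 1 / 2 ^ k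

/-- A martingale succeeds on `Z` if it is unbounded along `Z`. -/
def Succeeds (d : List Bool → ℝ) (Z : ℕ → Bool) : Prop :=
  ∀ C : ℝ, ∃ k, C < d (initialSegment Z k)

/-- A binary sequence is computably random if no computable martingale succeeds on it. -/
def IsComputablyRandomSeq (Z : ℕ → Bool) : Prop :=
  ∀ d : List Bool → ℝ, IsMartingale d → IsComputableFun d → ¬ Succeeds d Z

/-- The binary expansion of (the fractional part of) a point of `ℝⁿ`. The expansions of the
coordinates are interleaved: the entry with index `n * s + i`, where `i < n`, is the `s`-th binary
digit after the point of the `i`-th coordinate. -/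
noncomputable def binaryExpansion {n : ℕ} [NeZero n] (x : EuclideanSpace ℝ (Fin n)) : ℕ → Bool :=
  fun k => decide (Real.digits (Int.fract (x (Fin.ofNat n k))) 2 (k / n) = 1)

/-- A point of `ℝⁿ` is computably random if its binary expansion is. -/
def IsComputablyRandom {n : ℕ} [NeZero n] (x : EuclideanSpace ℝ (Fin n)) : Prop :=
  IsComputablyRandomSeq (binaryExpansion x)

/-- The basic dyadic cell `[σ]`: all points of the half-open unit cube whose binary expansion
extends `σ`. If `|σ| = n * s`, it is a half-open dyadic cube of side length `2 ^ (-s)`. -/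
def cell (n : ℕ) [NeZero n] (σ : List Bool) : Set (EuclideanSpace ℝ (Fin n)) :=
  {x | (∀ i, x i ∈ Set.Ico (0 : ℝ) 1) ∧ initialSegment (binaryExpansion x) σ.length = σ}

/-- `μ` is the probability measure `μ_M` on the unit cube determined by the martingale `M`, that is,
`μ [σ] = λ [σ] * M σ` for all `σ` whose length is a multiple of `n`. (The boundary faces that are
missing from `[0,1)ⁿ` carry no mass. There is at most one such `μ`, because the dyadic cubes form
a π-system that generates the Borel sets of `[0,1)ⁿ`.) -/
structure IsInducedMeasure {n : ℕ} [NeZero n] (M : List Bool → ℝ)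
    (μ : Measure (EuclideanSpace ℝ (Fin n))) : Prop where
  prob : IsProbabilityMeasure μ
  carried : μ (cell n [])ᶜ = 0
  apply_cell : ∀ σ : List Bool, n ∣ σ.length →
    μ (cell n σ) = volume (cell n σ) * ENNReal.ofReal (M σ)

/-- The Lebesgue derivative `D_λ μ (z) = lim_{r → 0+} μ (B_r(z)) / λ (B_r(z))` exists (a limit that
equals `∞` counts as well, so the negation of this says that there is no limit in `[0, ∞]`). -/
def HasLebesgueDerivativeAt {n : ℕ} (μ : Measure (EuclideanSpace ℝ (Fin n)))
    (z : EuclideanSpace ℝ (Fin n)) : Prop :=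
  ∃ l : ℝ≥0∞, Tendsto (fun r : ℝ => μ (Metric.ball z r) / volume (Metric.ball z r))
    (𝓝[>] 0) (𝓝 l)

/-- Condition (P1) for the measure `μ = μ_M`. -/
def PropertyP1 {n : ℕ} (μ : Measure (EuclideanSpace ℝ (Fin n)))
    (z : EuclideanSpace ℝ (Fin n)) : Prop :=
  μ ≪ volume ∧ ¬ HasLebesgueDerivativeAt μ z

/-- Condition (P2) for the martingale `M`. -/
def PropertyP2 (M : List Bool → ℝ) : Prop :=
  ∃ C : ℝ, ∀ σ, 0 < M σ ∧ M σ < C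

/-- The density of `μ` with respect to Lebesgue measure is bounded away from `0` and `∞` on the unit
cube. -/
def DensityBounded {n : ℕ} (μ : Measure (EuclideanSpace ℝ (Fin n))) : Prop :=
  ∃ c C : ℝ≥0, 0 < c ∧
    ∀ᵐ x ∂(volume.restrict {x : EuclideanSpace ℝ (Fin n) | ∀ i, x i ∈ Set.Icc (0 : ℝ) 1}),
      (c : ℝ≥0∞) ≤ μ.rnDeriv volume x ∧ μ.rnDeriv volume x ≤ (C : ℝ≥0∞)

end CompRand

/-! A martingale with values in `[5 / 8, 11 / 8]` is uniformly integrable on the cube, so its almost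
everywhere limit is the density of `μ_M` and lies between the same bounds
(`exists_isInducedMeasure`). What remains is to make such a martingale oscillate around `z`: at
arbitrarily small radii `r`, all cells meeting `B_r(z)` of some level much finer than `r` must carry
values at most `3 / 4`, and at other such radii values at least `5 / 4`. Then the derivative cannot
exist (`IsInducedMeasure.not_hasLebesgueDerivativeAt`).

The obstacle is that a ball around `z` need not lie in a dyadic cube that contains `z` and is of
comparable size. If a coordinate of `z` is very close to a dyadic rational, its neighbours across
that rational have quite different digits, and betting along the expansion of `z` does not control
them. Such closeness shows up as a long run of equal digits, hence two cases.

If some coordinate has constant digits on `[16 ^ j, 5 * 16 ^ j)` for infinitely many `j`, no success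
on `z` is needed. Nearby points on either side of the dyadic rational have runs as well, of zeros or
of ones. A strategy that remembers the first digit of a block and bets that it is repeated first
rises to `5 / 4` and later in the same run falls to `3 / 4`, simultaneously for all nearby points
(`runMartingale`).

Otherwise, for all large `j`, the ball of radius `2 ^ (-5 * 16 ^ j)` around `z` has the same first
`16 ^ j` digits in each coordinate as `z`. Given a computable martingale `d` that succeeds on the
expansion, a scaled copy of `d` is followed until the capital is `5 / 4`, then opposed until it is
`3 / 4`, and so on; since `d` is unbounded, every target is reached. Each time the capital is frozen
on all extensions for a whole block of lengths, which covers the cells near `z`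
(`exists_oscillating_martingale`).

Both strategies use integer capitals over explicit denominators, so that computability is immediate
and no real number has to be compared. -/

namespace CompRand

/-! ### Binary digits, dyadic rationals and cells -/

section

/-- The binary digit of `x` with index `s` after the point. -/
noncomputable def bit (x : ℝ) (s : ℕ) : Bool := decide (⌊x * 2 ^ (s + 1)⌋₊ % 2 = 1)

theorem initialSegment_succ (Z : ℕ → Bool) (k : ℕ) :
    initialSegment Z (k + 1) = initialSegment Z k ++ [Z k] := by
  simp [initialSegment, List.range_succ]

@[simp]
theorem length_initialSegment (Z : ℕ → Bool) (k : ℕ) : (initialSegment Z k).length = k := by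
  simp [initialSegment]

theorem initialSegment_eq_iff {Y Z : ℕ → Bool} {k : ℕ} :
    initialSegment Y k = initialSegment Z k ↔ ∀ j < k, Y j = Z j := by
  simp [initialSegment]

theorem binaryExpansion_apply {n : ℕ} [NeZero n] (x : EuclideanSpace ℝ (Fin n)) (k : ℕ) :
    binaryExpansion x k = bit (Int.fract (x (Fin.ofNat n k))) (k / n) := by
  unfold binaryExpansion bit
  rw [decide_eq_decide, Fin.ext_iff]
  simp [Real.digits]

theorem floor_mul_pow_div (x : ℝ) {s t : ℕ} (h : s ≤ t) :
    ⌊x * 2 ^ s⌋₊ = ⌊x * 2 ^ t⌋₊ / 2 ^ (t - s) := by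
  rw [← Nat.floor_div_natCast]
  congr 1
  have : (2 : ℝ) ^ t = 2 ^ (t - s) * 2 ^ s := by rw [← pow_add]; congr 1; omega
  push_cast
  rw [this]
  field_simp

theorem floor_mul_pow_succ (x : ℝ) (s : ℕ) :
    ⌊x * 2 ^ (s + 1)⌋₊ = 2 * ⌊x * 2 ^ s⌋₊ + (bit x s).toNat := by
  rw [floor_mul_pow_div x (Nat.le_succ s)]
  simp only [bit, Nat.succ_eq_add_one, Nat.add_sub_cancel_left, pow_one]
  have h2 := Nat.mod_two_eq_zero_or_one ⌊x * 2 ^ (s + 1)⌋₊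
  have h3 := Nat.div_add_mod ⌊x * 2 ^ (s + 1)⌋₊ 2
  rcases h2 with h | h <;> simp [h] <;> omega

theorem floor_eq_iff_bit_eq {x y : ℝ} (hx : x ∈ Set.Ico (0 : ℝ) 1) (hy : y ∈ Set.Ico (0 : ℝ) 1)
    (t : ℕ) : ⌊x * 2 ^ t⌋₊ = ⌊y * 2 ^ t⌋₊ ↔ ∀ s < t, bit x s = bit y s := by
  constructor
  · intro h s hs
    have : ⌊x * 2 ^ (s + 1)⌋₊ = ⌊y * 2 ^ (s + 1)⌋₊ := by
      rw [floor_mul_pow_div x (Nat.succ_le_of_lt hs), floor_mul_pow_div y (Nat.succ_le_of_lt hs), h]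
    simp [bit, this]
  · induction t with
    | zero =>
      intro _
      have h1 : ⌊x⌋₊ = 0 := Nat.floor_eq_zero.2 hx.2
      have h2 : ⌊y⌋₊ = 0 := Nat.floor_eq_zero.2 hy.2
      simp [h1, h2]
    | succ t ih =>
      intro h
      rw [floor_mul_pow_succ, floor_mul_pow_succ, ih fun s hs => h s (by omega), h t (by omega)]

/-- Points close to a dyadic rational of level `s` have constant digits from `s` on. -/
theorem bit_const_of_near {y : ℝ} (hy : y ∈ Set.Ico (0 : ℝ) 1) {s t : ℕ} (hst : s < t) {p : ℤ}
    (h : |y - p / 2 ^ s| < 1 / 2 ^ t) {k : ℕ} (hsk : s ≤ k) (hk : k < t) : bit y k = bit y s := by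
  have hps : (0 : ℝ) < 2 ^ s := by positivity
  -- To the left of `p / 2 ^ s` these digits are all ones, from it on all zeros: `y * 2 ^ (k + 1)`
  -- is within `1` of the even integer `p * 2 ^ (k - s) * 2`.
  have key : ∀ k, s ≤ k → k < t → bit y k = decide (y < p / 2 ^ s) := by
    intro k hsk hk
    have e1 : (2 : ℝ) ^ (k + 1) = 2 ^ (k - s) * 2 * 2 ^ s := by
      rw [mul_assoc, mul_comm 2, ← pow_succ, ← pow_add]; congr 1; omega
    have e2 : (1 : ℝ) / 2 ^ t * 2 ^ (k + 1) ≤ 1 := by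
      rw [div_mul_eq_mul_div, one_mul, div_le_one (by positivity)]
      exact pow_le_pow_right₀ (by norm_num) (by omega)
    have hd : |y * 2 ^ (k + 1) - p * 2 ^ (k - s) * 2| < 1 := by
      have : y * 2 ^ (k + 1) - p * 2 ^ (k - s) * 2 = (y - p / 2 ^ s) * 2 ^ (k + 1) := by
        rw [e1]; field_simp
      rw [this, abs_mul, abs_of_pos (by positivity : (0 : ℝ) < 2 ^ (k + 1))]
      exact lt_of_lt_of_le (mul_lt_mul_of_pos_right h (by positivity)) e2
    rw [abs_lt] at hd
    have hnn : 0 ≤ y * 2 ^ (k + 1) := mul_nonneg hy.1 (by positivity)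
    have hfl : ((⌊y * 2 ^ (k + 1)⌋₊ : ℕ) : ℤ) = ⌊y * 2 ^ (k + 1)⌋ := Int.natCast_floor_eq_floor hnn
    by_cases hlt : y < p / 2 ^ s
    · have h1 : y * 2 ^ (k + 1) < p * 2 ^ (k - s) * 2 := by
        rw [e1, mul_comm _ ((2 : ℝ) ^ s), ← mul_assoc, mul_assoc (p : ℝ)]
        exact mul_lt_mul_of_pos_right ((lt_div_iff₀ hps).1 hlt) (by positivity)
      have : ⌊y * 2 ^ (k + 1)⌋ = p * 2 ^ (k - s) * 2 - 1 := by
        rw [Int.floor_eq_iff]; push_cast; constructor <;> linarith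
      simp only [bit, hlt, decide_true, decide_eq_true_eq]
      rw [this] at hfl
      omega
    · have h1 : p * 2 ^ (k - s) * 2 ≤ y * 2 ^ (k + 1) := by
        rw [e1, mul_comm _ ((2 : ℝ) ^ s), ← mul_assoc, mul_assoc (p : ℝ)]
        exact mul_le_mul_of_nonneg_right ((div_le_iff₀ hps).1 (not_lt.1 hlt)) (by positivity)
      have : ⌊y * 2 ^ (k + 1)⌋ = p * 2 ^ (k - s) * 2 := by
        rw [Int.floor_eq_iff]; push_cast; constructor <;> linarith
      simp only [bit, hlt, decide_false, decide_eq_false_iff_not]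
      rw [this] at hfl
      omega
  rw [key k hsk hk, key s le_rfl hst]

/-- A run of zeros puts `y` close to the left endpoint of its dyadic interval of level `s`, a run of
ones close to the right one. Adding the repeated digit to the floor selects the endpoint. -/
theorem near_of_bit_const {y : ℝ} (hy : y ∈ Set.Ico (0 : ℝ) 1) {s t : ℕ} (hst : s ≤ t)
    (h : ∀ k, s ≤ k → k < t → bit y k = bit y s) : ∃ p : ℤ, |y - p / 2 ^ s| ≤ 1 / 2 ^ t := by
  have hps : (0 : ℝ) < 2 ^ s := by positivity
  have key : ∀ k, s ≤ k → k ≤ t → ⌊y * 2 ^ k⌋₊ + (bit y s).toNat =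
      (⌊y * 2 ^ s⌋₊ + (bit y s).toNat) * 2 ^ (k - s) := by
    intro k hk
    induction k, hk using Nat.le_induction with
    | base => simp
    | succ k hk ih =>
      intro hkt
      have := ih (by omega)
      rw [floor_mul_pow_succ, h k hk (by omega), show k + 1 - s = (k - s) + 1 by omega, pow_succ,
        ← mul_assoc, ← this]
      ring
  have h1 := key t hst le_rfl
  refine ⟨(⌊y * 2 ^ s⌋₊ + (bit y s).toNat : ℕ), ?_⟩
  have e : (2 : ℝ) ^ t = 2 ^ (t - s) * 2 ^ s := by rw [← pow_add]; congr 1; omega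
  have h2 : ((⌊y * 2 ^ t⌋₊ : ℕ) : ℝ) + ((bit y s).toNat : ℕ) =
      ((⌊y * 2 ^ s⌋₊ + (bit y s).toNat : ℕ) : ℝ) * 2 ^ (t - s) := by exact_mod_cast h1
  have hnn : 0 ≤ y * 2 ^ t := mul_nonneg hy.1 (by positivity)
  have f1 := Nat.floor_le hnn
  have f2 := Nat.lt_floor_add_one (y * 2 ^ t)
  have e3 : y - ((⌊y * 2 ^ s⌋₊ + (bit y s).toNat : ℕ) : ℝ) / 2 ^ s =
      (y * 2 ^ t - (((⌊y * 2 ^ t⌋₊ : ℕ) : ℝ) + ((bit y s).toNat : ℕ))) / 2 ^ t := by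
    rw [h2, e]; field_simp
  have e4 : (((⌊y * 2 ^ s⌋₊ + (bit y s).toNat : ℕ) : ℤ) : ℝ) =
    ((⌊y * 2 ^ s⌋₊ + (bit y s).toNat : ℕ) : ℝ) := by norm_cast
  rw [e4, e3, abs_div, abs_of_pos (by positivity : (0 : ℝ) < 2 ^ t)]
  gcongr
  rw [abs_le]
  cases bit y s <;> simp <;> constructor <;> linarith

/-- If the digits of `y` from `s` to `t` are not constant, the points at distance less than
`2 ^ (-t)` share its first `s` digits. -/
theorem floor_eq_of_not_const {x y : ℝ} (hx : x ∈ Set.Ico (0 : ℝ) 1) (hy : y ∈ Set.Ico (0 : ℝ) 1)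
    {s t : ℕ} (hst : s < t) (hne : ¬ ∀ k, s ≤ k → k < t → bit y k = bit y s)
    (h : |x - y| < 1 / 2 ^ t) : ⌊x * 2 ^ s⌋₊ = ⌊y * 2 ^ s⌋₊ := by
  have hps : (0 : ℝ) < 2 ^ s := by positivity
  -- By `bit_const_of_near`, `y` keeps the distance `2 ^ (-t)` from all dyadic rationals of level
  -- `s`, so `x` cannot leave the dyadic interval of `y`.
  have far : ∀ p : ℤ, 1 / 2 ^ t ≤ |y - p / 2 ^ s| := by
    intro p
    by_contra! hp
    exact hne fun k h1 h2 => bit_const_of_near hy hst hp h1 h2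
  rw [Nat.floor_eq_iff (mul_nonneg hx.1 hps.le)]
  have f1 := Nat.floor_le (mul_nonneg hy.1 hps.le)
  have f2 := Nat.lt_floor_add_one (y * 2 ^ s)
  set A := ⌊y * 2 ^ s⌋₊
  have h1 := far A
  have h2 := far (A + 1)
  push_cast at h1 h2
  rw [← div_le_iff₀ hps] at f1
  rw [← lt_div_iff₀ hps] at f2
  rw [abs_of_nonneg (by linarith)] at h1
  rw [abs_of_nonpos (by linarith)] at h2
  rw [abs_lt] at h
  rw [← div_le_iff₀ hps, ← lt_div_iff₀ hps]
  constructor <;> linarith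

variable {n : ℕ} [NeZero n]

theorem mem_cell_nil {x : EuclideanSpace ℝ (Fin n)} :
    x ∈ cell n [] ↔ ∀ i, x i ∈ Set.Ico (0 : ℝ) 1 := by
  simp [cell, initialSegment]

theorem mem_cell {x : EuclideanSpace ℝ (Fin n)} {σ : List Bool} :
    x ∈ cell n σ ↔ x ∈ cell n [] ∧ initialSegment (binaryExpansion x) σ.length = σ := by
  rw [mem_cell_nil]; rfl

theorem cell_subset (σ : List Bool) : cell n σ ⊆ cell n [] := fun _ h => (mem_cell.1 h).1

theorem binaryExpansion_level (x : EuclideanSpace ℝ (Fin n)) (s : ℕ) (i : Fin n) :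
    binaryExpansion x (n * s + i) = bit (Int.fract (x i)) s := by
  rw [binaryExpansion_apply]
  have h1 : Fin.ofNat n (n * s + i) = i := by
    rw [Fin.ext_iff]; simp [Nat.mod_eq_of_lt i.2]
  have h2 : (n * s + i) / n = s := by
    rw [Nat.mul_add_div (NeZero.pos n), Nat.div_eq_of_lt i.2, add_zero]
  rw [h1, h2]

theorem binaryExpansion_level_of_mem {x : EuclideanSpace ℝ (Fin n)} (hx : x ∈ cell n [])
    (s : ℕ) (i : Fin n) : binaryExpansion x (n * s + i) = bit (x i) s := by
  rw [binaryExpansion_level, Int.fract_eq_self.2 (mem_cell_nil.1 hx i)]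

theorem initialSegment_eq_iff_floor {x y : EuclideanSpace ℝ (Fin n)} (hx : x ∈ cell n [])
    (hy : y ∈ cell n []) (t : ℕ) :
    initialSegment (binaryExpansion x) (n * t) = initialSegment (binaryExpansion y) (n * t) ↔
      ∀ i, ⌊x i * 2 ^ t⌋₊ = ⌊y i * 2 ^ t⌋₊ := by
  rw [initialSegment_eq_iff]
  simp_rw [floor_eq_iff_bit_eq (mem_cell_nil.1 hx _) (mem_cell_nil.1 hy _)]
  constructor
  · intro h i s hs
    rw [← binaryExpansion_level_of_mem hx, ← binaryExpansion_level_of_mem hy]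
    refine h _ ?_
    calc n * s + i < n * s + n := by have := i.2; omega
      _ = n * (s + 1) := by ring
      _ ≤ n * t := Nat.mul_le_mul_left _ hs
  · intro h j hj
    have h1 : n * (j / n) + (j % n) = j := Nat.div_add_mod j n
    have h2 := h ⟨j % n, Nat.mod_lt _ (NeZero.pos n)⟩ (j / n)
      (Nat.div_lt_of_lt_mul hj)
    rw [← binaryExpansion_level_of_mem hx, ← binaryExpansion_level_of_mem hy] at h2
    simpa [h1] using h2

theorem dist_le_of_floor_eq {x y : EuclideanSpace ℝ (Fin n)} (hx : x ∈ cell n [])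
    (hy : y ∈ cell n []) {t : ℕ} (h : ∀ i, ⌊x i * 2 ^ t⌋₊ = ⌊y i * 2 ^ t⌋₊) :
    dist x y ≤ n / 2 ^ t := by
  rw [EuclideanSpace.dist_eq]
  apply Real.sqrt_le_iff.2 ⟨by positivity, ?_⟩
  have hi : ∀ i, dist (x i) (y i) ^ 2 ≤ (1 / 2 ^ t) ^ 2 := by
    intro i
    have hp : (0 : ℝ) < 2 ^ t := by positivity
    have a1 := Nat.floor_le (mul_nonneg (mem_cell_nil.1 hx i).1 hp.le)
    have a2 := Nat.lt_floor_add_one (x i * 2 ^ t)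
    have b1 := Nat.floor_le (mul_nonneg (mem_cell_nil.1 hy i).1 hp.le)
    have b2 := Nat.lt_floor_add_one (y i * 2 ^ t)
    rw [h i] at a1 a2
    have : dist (x i) (y i) ≤ 1 / 2 ^ t := by
      rw [Real.dist_eq, le_div_iff₀ hp]
      nth_rw 1 [← abs_of_pos hp]
      rw [← abs_mul, abs_le]
      constructor <;> nlinarith
    gcongr
  calc ∑ i, dist (x i) (y i) ^ 2 ≤ ∑ _i : Fin n, (1 / 2 ^ t : ℝ) ^ 2 :=
        Finset.sum_le_sum fun i _ => hi i
    _ = n * (1 / 2 ^ t) ^ 2 := by simp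
    _ ≤ n ^ 2 * (1 / 2 ^ t) ^ 2 := by
        gcongr
        have : (1 : ℝ) ≤ n := by exact_mod_cast NeZero.one_le
        nlinarith
    _ = (n / 2 ^ t) ^ 2 := by ring

theorem dist_le_of_mem_cell {x y : EuclideanSpace ℝ (Fin n)} {σ : List Bool} {t : ℕ}
    (hσ : σ.length = n * t) (hx : x ∈ cell n σ) (hy : y ∈ cell n σ) : dist x y ≤ n / 2 ^ t := by
  rw [mem_cell, hσ] at hx hy
  exact dist_le_of_floor_eq hx.1 hy.1
    ((initialSegment_eq_iff_floor hx.1 hy.1 t).1 (hx.2.trans hy.2.symm))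

end

/-! ### Volumes of cells and the measure induced by a martingale -/

section

theorem bit_add {x : ℝ} (hx : x ∈ Set.Ico (0 : ℝ) 1) {l : ℕ} (h : bit x l = false) :
    x + 1 / 2 ^ (l + 1) ∈ Set.Ico (0 : ℝ) 1 ∧ bit (x + 1 / 2 ^ (l + 1)) l = true ∧
      ∀ s < l, bit (x + 1 / 2 ^ (l + 1)) s = bit x s := by
  have hp : (0 : ℝ) < 2 ^ (l + 1) := by positivity
  have hp' : (0 : ℝ) < 2 ^ l := by positivity
  have e : (x + 1 / 2 ^ (l + 1)) * 2 ^ (l + 1) = x * 2 ^ (l + 1) + 1 := by field_simp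
  have f : ⌊(x + 1 / 2 ^ (l + 1)) * 2 ^ (l + 1)⌋₊ = ⌊x * 2 ^ (l + 1)⌋₊ + 1 := by
    rw [e, Nat.floor_add_one (mul_nonneg hx.1 hp.le)]
  have f1 := floor_mul_pow_succ x l
  have f2 := floor_mul_pow_succ (x + 1 / 2 ^ (l + 1)) l
  rw [h] at f1
  simp only [Bool.toNat_false, add_zero] at f1
  rw [f, f1] at f2
  have b : bit (x + 1 / 2 ^ (l + 1)) l = true := by
    cases hb : bit (x + 1 / 2 ^ (l + 1)) l
    · rw [hb] at f2; simp at f2; omega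
    · rfl
  have f3 : ⌊(x + 1 / 2 ^ (l + 1)) * 2 ^ l⌋₊ = ⌊x * 2 ^ l⌋₊ := by
    rw [b] at f2; simp at f2; rw [one_div]; omega
  have h0 : 0 ≤ x + 1 / 2 ^ (l + 1) := add_nonneg hx.1 (by positivity)
  have h1 : x + 1 / 2 ^ (l + 1) < 1 := by
    have g1 := Nat.lt_floor_add_one ((x + 1 / 2 ^ (l + 1)) * 2 ^ l)
    have g2 : ⌊x * 2 ^ l⌋₊ + 1 ≤ 2 ^ l := by
      have : (⌊x * 2 ^ l⌋₊ : ℝ) < 2 ^ l :=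
        lt_of_le_of_lt (Nat.floor_le (mul_nonneg hx.1 hp'.le)) (by nlinarith [hx.2])
      exact_mod_cast this
    have g3 : (⌊x * 2 ^ l⌋₊ : ℝ) + 1 ≤ 2 ^ l := by exact_mod_cast g2
    rw [f3] at g1
    by_contra! hc
    nlinarith
  exact ⟨⟨h0, h1⟩, b, (floor_eq_iff_bit_eq ⟨h0, h1⟩ hx l).1 f3⟩

theorem bit_sub {x : ℝ} (hx : x ∈ Set.Ico (0 : ℝ) 1) {l : ℕ} (h : bit x l = true) :
    x - 1 / 2 ^ (l + 1) ∈ Set.Ico (0 : ℝ) 1 ∧ bit (x - 1 / 2 ^ (l + 1)) l = false ∧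
      ∀ s < l, bit (x - 1 / 2 ^ (l + 1)) s = bit x s := by
  have hp : (0 : ℝ) < 2 ^ (l + 1) := by positivity
  have f1 := floor_mul_pow_succ x l
  rw [h] at f1
  simp only [Bool.toNat_true] at f1
  have g0 := Nat.floor_le (mul_nonneg hx.1 hp.le)
  have g1 : (1 : ℝ) ≤ ⌊x * 2 ^ (l + 1)⌋₊ := by
    have : 1 ≤ ⌊x * 2 ^ (l + 1)⌋₊ := by omega
    exact_mod_cast this
  have h0 : 0 ≤ x - 1 / 2 ^ (l + 1) := by
    rw [sub_nonneg, div_le_iff₀ hp]; linarith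
  have h1 : x - 1 / 2 ^ (l + 1) < 1 :=
    lt_of_le_of_lt (sub_le_self _ (by positivity)) hx.2
  have f : ⌊x * 2 ^ (l + 1)⌋₊ = ⌊(x - 1 / 2 ^ (l + 1)) * 2 ^ (l + 1)⌋₊ + 1 := by
    rw [← Nat.floor_add_one (mul_nonneg h0 hp.le)]
    congr 1; field_simp; ring
  have f2 := floor_mul_pow_succ (x - 1 / 2 ^ (l + 1)) l
  have b : bit (x - 1 / 2 ^ (l + 1)) l = false := by
    cases hb : bit (x - 1 / 2 ^ (l + 1)) l
    · rfl
    · rw [hb] at f2; simp only [Bool.toNat_true] at f2; omega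
  have := (bit_add ⟨h0, h1⟩ b).2.2
  rw [sub_add_cancel] at this
  exact ⟨⟨h0, h1⟩, b, fun s hs => (this s hs).symm⟩

variable {n : ℕ} [NeZero n]

theorem mem_cell_append {x : EuclideanSpace ℝ (Fin n)} {σ : List Bool} {b : Bool} :
    x ∈ cell n (σ ++ [b]) ↔ x ∈ cell n σ ∧
      bit (x (Fin.ofNat n σ.length)) (σ.length / n) = b := by
  rw [mem_cell, mem_cell (σ := σ), List.length_append, List.length_singleton, initialSegment_succ,
    and_assoc]
  refine and_congr_right fun hx => ?_
  rw [binaryExpansion_apply, Int.fract_eq_self.2 (mem_cell_nil.1 hx _)]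
  constructor
  · intro h
    have := List.append_inj h (by simp)
    simpa using this
  · rintro ⟨h1, h2⟩
    rw [h1, h2]

theorem cell_shift {x y : EuclideanSpace ℝ (Fin n)} {σ : List Bool} (hx : x ∈ cell n σ)
    (hne : ∀ j, j ≠ Fin.ofNat n σ.length → y j = x j)
    (hy : y (Fin.ofNat n σ.length) ∈ Set.Ico (0 : ℝ) 1)
    (hb : ∀ s < σ.length / n, bit (y (Fin.ofNat n σ.length)) s =
      bit (x (Fin.ofNat n σ.length)) s) : y ∈ cell n σ := by
  have hx0 := cell_subset σ hx
  have hy0 : y ∈ cell n [] := by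
    rw [mem_cell_nil]
    intro j
    by_cases hj : j = Fin.ofNat n σ.length
    · rwa [hj]
    · rw [hne j hj]; exact mem_cell_nil.1 hx0 j
  rw [mem_cell] at hx ⊢
  refine ⟨hy0, Eq.trans ?_ hx.2⟩
  rw [initialSegment_eq_iff]
  intro k hk
  rw [binaryExpansion_apply, binaryExpansion_apply, Int.fract_eq_self.2 (mem_cell_nil.1 hx0 _),
    Int.fract_eq_self.2 (mem_cell_nil.1 hy0 _)]
  by_cases hj : Fin.ofNat n k = Fin.ofNat n σ.length
  · rw [hj]
    refine hb _ ?_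
    rw [Fin.ext_iff] at hj
    simp only [Fin.val_ofNat] at hj
    by_contra! hc
    have h1 := Nat.div_add_mod k n
    have h2 := Nat.div_add_mod σ.length n
    have := Nat.mul_le_mul_left n hc
    omega
  · rw [hne _ hj]

/-- Translation by `2 ^ (-(l + 1))` in the coordinate to which the new digit belongs exchanges the
halves: it flips this digit and no earlier one. -/
theorem volume_cell_false_eq_true (σ : List Bool) :
    volume (cell n (σ ++ [false])) = volume (cell n (σ ++ [true])) := by
  classical
  set i := Fin.ofNat n σ.length
  set l := σ.length / n
  set v : EuclideanSpace ℝ (Fin n) := EuclideanSpace.single i (1 / 2 ^ (l + 1)) with hv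
  have hvi : v i = 1 / 2 ^ (l + 1) := by simp [hv]
  have hvj : ∀ j, j ≠ i → v j = 0 := fun j hj => by simp [hv, hj]
  apply le_antisymm
  · rw [← measure_preimage_add_right volume v (cell n (σ ++ [true]))]
    refine measure_mono fun x hx => ?_
    rw [mem_cell_append] at hx
    obtain ⟨h1, h2, h3⟩ := bit_add (mem_cell_nil.1 (cell_subset _ hx.1) i) hx.2
    have hyi : (x + v) i = x i + 1 / 2 ^ (l + 1) := by rw [PiLp.add_apply, hvi]
    rw [Set.mem_preimage, mem_cell_append]
    refine ⟨cell_shift hx.1 (fun j hj => ?_) ?_ ?_, ?_⟩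
    · rw [PiLp.add_apply, hvj j hj, add_zero]
    · rw [hyi]; exact h1
    · rw [hyi]; exact h3
    · rw [hyi]; exact h2
  · rw [← measure_preimage_add_right volume (-v) (cell n (σ ++ [false]))]
    refine measure_mono fun x hx => ?_
    rw [mem_cell_append] at hx
    obtain ⟨h1, h2, h3⟩ := bit_sub (mem_cell_nil.1 (cell_subset _ hx.1) i) hx.2
    have hyi : (x + -v) i = x i - 1 / 2 ^ (l + 1) := by
      rw [PiLp.add_apply, PiLp.neg_apply, hvi, sub_eq_add_neg]
    rw [Set.mem_preimage, mem_cell_append]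
    refine ⟨cell_shift hx.1 (fun j hj => ?_) ?_ ?_, ?_⟩
    · rw [PiLp.add_apply, PiLp.neg_apply, hvj j hj, neg_zero, add_zero]
    · rw [hyi]; exact h1
    · rw [hyi]; exact h3
    · rw [hyi]; exact h2

theorem measurable_bit (s : ℕ) : Measurable fun x : ℝ => bit x s := by
  unfold bit
  have h : Measurable fun x : ℝ => ⌊x * 2 ^ (s + 1)⌋₊ :=
    Nat.measurable_floor.comp (measurable_id.mul_const _)
  exact (measurable_from_top (f := fun m : ℕ => decide (m % 2 = 1))).comp h

theorem measurable_binaryExpansion (k : ℕ) :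
    Measurable fun x : EuclideanSpace ℝ (Fin n) => binaryExpansion x k := by
  simp_rw [binaryExpansion_apply]
  refine (measurable_bit _).comp (measurable_fract.comp ?_)
  fun_prop

theorem measurableSet_initialSegment_eq (k : ℕ) (σ : List Bool) :
    MeasurableSet {x : EuclideanSpace ℝ (Fin n) | initialSegment (binaryExpansion x) k = σ} := by
  by_cases h : ∃ x : EuclideanSpace ℝ (Fin n), initialSegment (binaryExpansion x) k = σ
  · obtain ⟨x, rfl⟩ := h
    simp only [initialSegment_eq_iff, Set.ofPred_forall]
    refine MeasurableSet.iInter fun j => MeasurableSet.iInter fun _ => ?_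
    exact measurable_binaryExpansion j (measurableSet_singleton _)
  · push Not at h
    convert MeasurableSet.empty
    ext x
    simp [h x]

theorem measurableSet_cell_nil : MeasurableSet (cell n []) := by
  have : cell n [] = ⋂ i, {x : EuclideanSpace ℝ (Fin n) | x i ∈ Set.Ico (0 : ℝ) 1} := by
    ext x; simp only [mem_cell_nil, Set.mem_iInter, Set.mem_ofPred_eq]
  rw [this]
  refine MeasurableSet.iInter fun i => ?_
  exact measurableSet_Ico.preimage
    (by fun_prop : Measurable fun x : EuclideanSpace ℝ (Fin n) => x i)

theorem cell_eq_inter (σ : List Bool) :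
    cell n σ = {x | initialSegment (binaryExpansion x) σ.length = σ} ∩ cell n [] := by
  ext x; rw [mem_cell, and_comm]; rfl

theorem measurableSet_cell (σ : List Bool) : MeasurableSet (cell n σ) := by
  rw [cell_eq_inter]
  exact (measurableSet_initialSegment_eq _ _).inter measurableSet_cell_nil

theorem volume_cell_nil : volume (cell n []) = 1 := by
  have h :=
    (EuclideanSpace.volume_preserving_symm_measurableEquiv_toLp (Fin n)).measure_preimage_equiv
    (Set.univ.pi fun _ => Set.Ico (0 : ℝ) 1)
  rw [Real.volume_pi_Ico] at h
  simp only [sub_zero, ENNReal.ofReal_one, Finset.prod_const_one] at h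
  rw [← h]
  congr 1
  ext x
  rw [mem_cell_nil]
  simp

theorem volume_closed_cube {n : ℕ} :
    volume {x : EuclideanSpace ℝ (Fin n) | ∀ i, x i ∈ Set.Icc (0 : ℝ) 1} = 1 := by
  have h :=
    (EuclideanSpace.volume_preserving_symm_measurableEquiv_toLp (Fin n)).measure_preimage_equiv
    (Set.univ.pi fun _ => Set.Icc (0 : ℝ) 1)
  rw [volume_pi_pi] at h
  simp only [Real.volume_Icc, sub_zero, ENNReal.ofReal_one, Finset.prod_const_one] at h
  rw [← h]
  congr 1
  ext x
  simp [Pi.le_def, forall_and]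

theorem cell_eq_union (σ : List Bool) :
    cell n σ = cell n (σ ++ [false]) ∪ cell n (σ ++ [true]) := by
  ext x
  simp only [Set.mem_union, mem_cell_append]
  cases bit (x (Fin.ofNat n σ.length)) (σ.length / n) <;> simp

theorem disjoint_cell_append (σ : List Bool) :
    Disjoint (cell n (σ ++ [false])) (cell n (σ ++ [true])) := by
  rw [Set.disjoint_left]
  intro x hx hx'
  rw [mem_cell_append] at hx hx'
  exact Bool.false_ne_true (hx.2.symm.trans hx'.2)

theorem volume_cell_append (σ : List Bool) (b : Bool) :
    volume (cell n σ) = 2 * volume (cell n (σ ++ [b])) := by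
  rw [cell_eq_union σ, measure_union (disjoint_cell_append σ) (measurableSet_cell _),
    volume_cell_false_eq_true, two_mul]
  cases b
  · rw [volume_cell_false_eq_true]
  · rfl

/-- The filtration of the Borel sets of `ℝⁿ` generated by the binary digits. -/
noncomputable def digitFiltration (n : ℕ) [NeZero n] :
    Filtration ℕ (inferInstance : MeasurableSpace (EuclideanSpace ℝ (Fin n))) where
  seq k := MeasurableSpace.comap (fun x => initialSegment (binaryExpansion x) k) ⊤
  mono' := by
    intro k l hkl s hs
    obtain ⟨A, _, rfl⟩ := hs
    refine ⟨{σ | σ.take k ∈ A}, trivial, ?_⟩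
    ext x
    have : List.take k (initialSegment (binaryExpansion x) l) =
        initialSegment (binaryExpansion x) k := by
      simp [initialSegment, ← List.map_take, List.take_range, hkl]
    simp [this]
  le' := by
    intro k s hs
    obtain ⟨A, _, rfl⟩ := hs
    have : (fun x : EuclideanSpace ℝ (Fin n) => initialSegment (binaryExpansion x) k) ⁻¹' A =
        ⋃ σ ∈ A, {x | initialSegment (binaryExpansion x) k = σ} := by
      ext x; simp
    rw [this]
    exact MeasurableSet.biUnion (Set.to_countable A) fun σ _ => measurableSet_initialSegment_eq k σ

/-- The martingale `M` on strings as a process on `ℝⁿ`. -/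
noncomputable def digitValue (n : ℕ) [NeZero n] (M : List Bool → ℝ) (k : ℕ)
    (x : EuclideanSpace ℝ (Fin n)) : ℝ :=
  M (initialSegment (binaryExpansion x) k)

/-- Lebesgue measure on the half-open unit cube. -/
noncomputable abbrev cubeMeasure (n : ℕ) [NeZero n] : Measure (EuclideanSpace ℝ (Fin n)) :=
  volume.restrict (cell n [])

instance : IsProbabilityMeasure (cubeMeasure n) :=
  ⟨by rw [Measure.restrict_apply_univ, volume_cell_nil]⟩

theorem stronglyMeasurable_digitValue (M : List Bool → ℝ) (k : ℕ) :
    StronglyMeasurable[digitFiltration n k] (digitValue n M k) := by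
  refine Measurable.stronglyMeasurable ?_
  intro s _
  exact ⟨M ⁻¹' s, trivial, rfl⟩

theorem integrable_digitValue {M : List Bool → ℝ} {C : ℝ} (hC : ∀ σ, |M σ| ≤ C) (k : ℕ) :
    Integrable (digitValue n M k) (cubeMeasure n) :=
  Integrable.of_bound ((stronglyMeasurable_digitValue M k).mono
    ((digitFiltration n).le k)).aestronglyMeasurable C (Eventually.of_forall fun _ => hC _)

theorem setIntegral_cell {M : List Bool → ℝ} (σ : List Bool) :
    ∫ x in cell n σ, digitValue n M σ.length x = volume.real (cell n σ) * M σ := by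
  rw [setIntegral_congr_fun (measurableSet_cell σ) (g := fun _ => M σ)
    (fun x hx => by simp only [digitValue, (mem_cell.1 hx).2])]
  simp

theorem setIntegral_cell_succ {M : List Bool → ℝ} (hM : IsMartingale M) {C : ℝ}
    (hC : ∀ σ, |M σ| ≤ C) (σ : List Bool) :
    ∫ x in cell n σ, digitValue n M (σ.length + 1) x = volume.real (cell n σ) * M σ := by
  have hi : ∀ τ : List Bool, IntegrableOn (digitValue n M (σ.length + 1)) (cell n τ) := fun τ =>
    IntegrableOn.mono_set (integrable_digitValue hC _) (cell_subset τ)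
  have hb : ∀ b, ∫ x in cell n (σ ++ [b]), digitValue n M (σ.length + 1) x =
      volume.real (cell n (σ ++ [b])) * M (σ ++ [b]) := fun b => by
    rw [← setIntegral_cell, List.length_append, List.length_singleton]
  have hv : ∀ b, volume.real (cell n σ) = 2 * volume.real (cell n (σ ++ [b])) := fun b => by
    rw [measureReal_def, volume_cell_append σ b]; simp [measureReal_def]
  nth_rw 1 [cell_eq_union σ]
  rw [setIntegral_union (disjoint_cell_append σ) (measurableSet_cell _) (hi _) (hi _), hb, hb]
  have h1 := hv true
  have h2 := hv false
  have h3 := hM.fair σ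
  have : volume.real (cell n (σ ++ [false])) = volume.real (cell n (σ ++ [true])) := by linarith
  rw [this, ← mul_add, h3, h1]
  ring

/-- Within the cube, an event of the `k`-th σ-algebra is a countable disjoint union of cells of
length `k`. On each of these, fairness and the equal volumes of the halves make the two integrals
agree. -/
theorem martingale_digitValue {M : List Bool → ℝ} (hM : IsMartingale M) {C : ℝ}
    (hC : ∀ σ, |M σ| ≤ C) :
    Martingale (digitValue n M) (digitFiltration n) (cubeMeasure n) := by
  refine martingale_of_setIntegral_eq_succ (fun k => stronglyMeasurable_digitValue M k)
    (integrable_digitValue hC) fun k s hs => ?_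
  have hs' := (digitFiltration n).le k s hs
  obtain ⟨A, _, rfl⟩ := hs
  rw [Measure.restrict_restrict hs']
  have hu : (fun x : EuclideanSpace ℝ (Fin n) => initialSegment (binaryExpansion x) k) ⁻¹' A ∩
      cell n [] = ⋃ σ : {σ : List Bool // σ ∈ A ∧ σ.length = k}, cell n σ.1 := by
    ext x
    simp only [Set.mem_inter_iff, Set.mem_preimage, Set.mem_iUnion, Subtype.exists]
    constructor
    · rintro ⟨h1, h2⟩
      exact ⟨_, ⟨h1, by simp⟩, mem_cell.2 ⟨h2, by simp⟩⟩
    · rintro ⟨σ, ⟨h1, rfl⟩, h2⟩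
      rw [mem_cell] at h2
      exact ⟨by rw [h2.2]; exact h1, h2.1⟩
  have hd : Pairwise (Function.onFun Disjoint
      fun σ : {σ : List Bool // σ ∈ A ∧ σ.length = k} => cell n σ.1) := by
    rintro ⟨σ, h1, h2⟩ ⟨τ, h3, h4⟩ hne
    rw [Function.onFun, Set.disjoint_left]
    intro x hx hx'
    rw [mem_cell] at hx hx'
    apply hne
    simp only [Subtype.mk.injEq]
    refine hx.2.symm.trans (Eq.trans ?_ hx'.2)
    simp only [h2, h4]
  have hsub : (⋃ σ : {σ : List Bool // σ ∈ A ∧ σ.length = k}, cell n σ.1) ⊆ cell n [] :=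
    Set.iUnion_subset fun σ => cell_subset _
  rw [hu, integral_iUnion (fun σ => measurableSet_cell _) hd
      (IntegrableOn.mono_set (integrable_digitValue hC _) hsub),
    integral_iUnion (fun σ => measurableSet_cell _) hd
      (IntegrableOn.mono_set (integrable_digitValue hC _) hsub)]
  refine tsum_congr ?_
  rintro ⟨σ, h1, rfl⟩
  rw [setIntegral_cell, setIntegral_cell_succ hM hC]

/-- A martingale with values in `[c, C]`, where `c > 0`, induces a measure with bounded density. -/
theorem exists_isInducedMeasure {M : List Bool → ℝ} (hM : IsMartingale M) (h1 : M [] = 1)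
    {c C : ℝ} (hc : 0 < c) (hcM : ∀ σ, c ≤ M σ) (hMC : ∀ σ, M σ ≤ C) :
    ∃ μ : Measure (EuclideanSpace ℝ (Fin n)), IsInducedMeasure M μ ∧ μ ≪ volume ∧
      DensityBounded μ := by
  have hC : ∀ σ, |M σ| ≤ C := fun σ => by
    rw [abs_of_nonneg (hc.le.trans (hcM σ))]; exact hMC σ
  have hmart := martingale_digitValue (n := n) hM hC
  set P := cubeMeasure n
  have hbdd : ∀ k, eLpNorm (digitValue n M k) 1 P ≤ (C.toNNReal : ℝ≥0∞) := by
    intro k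
    refine (eLpNorm_le_of_ae_bound (C := C) (Eventually.of_forall fun _ => hC _)).trans ?_
    simp [ENNReal.ofReal]
  have hui : UniformIntegrable (digitValue n M) 1 P := by
    refine uniformIntegrable_of le_rfl ENNReal.one_ne_top
      (fun k => ((stronglyMeasurable_digitValue M k).mono
        ((digitFiltration n).le k)).aestronglyMeasurable) fun ε _ => ⟨C.toNNReal + 1, fun k => ?_⟩
    have : {x | C.toNNReal + 1 ≤ ‖digitValue n M k x‖₊} = ∅ := by
      ext x
      simp only [Set.mem_ofPred_eq, Set.mem_empty_iff_false, iff_false, not_le]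
      rw [← NNReal.coe_lt_coe, coe_nnnorm, Real.norm_eq_abs]
      have h1 : |digitValue n M k x| ≤ C := hC _
      have h2 := Real.le_coe_toNNReal C
      push_cast
      linarith
    rw [this]
    simp
  -- The bounded martingale converges almost everywhere to a function `g` that closes it. This limit
  -- is the density.
  obtain ⟨g, hlim, hcond, hgm⟩ : ∃ g : EuclideanSpace ℝ (Fin n) → ℝ,
      (∀ᵐ x ∂P, Tendsto (fun k => digitValue n M k x) atTop (𝓝 (g x))) ∧
      (∀ k, digitValue n M k =ᵐ[P] P[g | digitFiltration n k]) ∧ StronglyMeasurable g :=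
    ⟨_, hmart.submartingale.ae_tendsto_limitProcess hbdd,
      fun k => hmart.ae_eq_condExp_limitProcess hui k, Filtration.stronglyMeasurable_limit_process'⟩
  have hgb : ∀ᵐ x ∂P, c ≤ g x ∧ g x ≤ C := by
    filter_upwards [hlim] with x hx
    exact ⟨ge_of_tendsto hx (Eventually.of_forall fun k => hcM _),
      le_of_tendsto hx (Eventually.of_forall fun k => hMC _)⟩
  have hgi : Integrable g P := by
    refine Integrable.of_bound hgm.aestronglyMeasurable C ?_
    filter_upwards [hgb] with x hx
    rw [Real.norm_eq_abs, abs_of_nonneg (hc.le.trans hx.1)]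
    exact hx.2
  have hcell : ∀ σ, ∫ x in cell n σ, g x = volume.real (cell n σ) * M σ := by
    intro σ
    set S : Set (EuclideanSpace ℝ (Fin n)) :=
      {x | initialSegment (binaryExpansion x) σ.length = σ}
    have hS : MeasurableSet[digitFiltration n σ.length] S := ⟨{σ}, trivial, rfl⟩
    have hS' := (digitFiltration n).le _ _ hS
    have e := setIntegral_condExp ((digitFiltration n).le σ.length) hgi hS
    have e' : ∫ x in S, (P[g | digitFiltration n σ.length]) x ∂P =
        ∫ x in S, digitValue n M σ.length x ∂P :=
      integral_congr_ae (ae_restrict_of_ae (hcond _).symm)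
    rw [e', Measure.restrict_restrict hS', ← cell_eq_inter, setIntegral_cell] at e
    exact e.symm
  set f := fun x => ENNReal.ofReal (g x) with hf
  have hfm : Measurable f := hgm.measurable.ennreal_ofReal
  have happ : ∀ σ, P.withDensity f (cell n σ) =
      volume (cell n σ) * ENNReal.ofReal (M σ) := by
    intro σ
    rw [withDensity_apply _ (measurableSet_cell σ),
      ← ofReal_integral_eq_lintegral_ofReal hgi.integrableOn
        (ae_restrict_of_ae (hgb.mono fun x hx => hc.le.trans hx.1)),
      Measure.restrict_restrict (measurableSet_cell σ),
      Set.inter_eq_left.2 (cell_subset σ), hcell,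
      ENNReal.ofReal_mul measureReal_nonneg, ofReal_measureReal (ne_top_of_le_ne_top
        (by rw [volume_cell_nil]; exact ENNReal.one_ne_top) (measure_mono (cell_subset σ)))]
  have hcarr : P.withDensity f (cell n [])ᶜ = 0 := by
    apply withDensity_absolutelyContinuous
    rw [Measure.restrict_apply measurableSet_cell_nil.compl, Set.compl_inter_self, measure_empty]
  refine ⟨P.withDensity f, ⟨⟨?_⟩, hcarr, fun σ _ => happ σ⟩, ?_, ?_⟩
  · rw [← measure_add_measure_compl (measurableSet_cell_nil (n := n)), hcarr, happ, h1,
      volume_cell_nil]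
    simp
  · exact (withDensity_absolutelyContinuous _ _).trans
      (Measure.absolutelyContinuous_of_le Measure.restrict_le_self)
  · refine ⟨c.toNNReal, C.toNNReal, by simpa using hc, ?_⟩
    -- Both cubes have volume `1`, so the missing faces are null.
    have hcube : (cell n [] : Set (EuclideanSpace ℝ (Fin n))) =ᵐ[volume]
        {x : EuclideanSpace ℝ (Fin n) | ∀ i, x i ∈ Set.Icc (0 : ℝ) 1} := by
      refine ae_eq_of_subset_of_measure_ge (fun x hx i => ?_) ?_
        measurableSet_cell_nil.nullMeasurableSet ?_
      · exact Set.Ico_subset_Icc_self (mem_cell_nil.1 hx i)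
      · rw [volume_cell_nil, volume_closed_cube]
      · rw [volume_closed_cube]; exact ENNReal.one_ne_top
    rw [← Measure.restrict_congr_set hcube]
    have hind : P.withDensity f = volume.withDensity ((cell n []).indicator f) := by
      rw [withDensity_indicator measurableSet_cell_nil]
    have hr := Measure.rnDeriv_withDensity (volume : Measure (EuclideanSpace ℝ (Fin n)))
      (hfm.indicator (measurableSet_cell_nil (n := n)))
    rw [hind]
    filter_upwards [ae_restrict_of_ae hr, hgb, ae_restrict_mem measurableSet_cell_nil]
      with x hx hb hmem
    rw [hx, Set.indicator_of_mem hmem, hf]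
    exact ⟨ENNReal.ofReal_le_ofReal hb.1, ENNReal.ofReal_le_ofReal hb.2⟩

end

/-! ### Balls, cells and failure of differentiability -/

section

variable {n : ℕ} [NeZero n]

theorem mem_cell_initialSegment {x : EuclideanSpace ℝ (Fin n)} (hx : x ∈ cell n []) (k : ℕ) :
    x ∈ cell n (initialSegment (binaryExpansion x) k) :=
  mem_cell.2 ⟨hx, by simp⟩

theorem measure_biUnion_cell (μ : Measure (EuclideanSpace ℝ (Fin n))) {m : ℕ}
    {A : Set (List Bool)} (hA : ∀ σ ∈ A, σ.length = m) :
    μ (⋃ σ ∈ A, cell n σ) = ∑' σ : A, μ (cell n σ.1) := by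
  refine measure_biUnion (Set.to_countable A) ?_ fun σ _ => measurableSet_cell σ
  intro σ hσ τ hτ hne
  rw [Function.onFun, Set.disjoint_left]
  intro x hx hx'
  rw [mem_cell] at hx hx'
  exact hne (hx.2.symm.trans (by rw [hA σ hσ, ← hA τ hτ]; exact hx'.2))

/-- The cells of level `t` that meet the ball cover its part in the cube, and their diameter keeps
them inside the enlarged ball. The intersection with the cube is kept because `z` may lie on the
boundary. -/
theorem IsInducedMeasure.ball_le {M : List Bool → ℝ} {μ : Measure (EuclideanSpace ℝ (Fin n))}
    (hμ : IsInducedMeasure M μ) {z : EuclideanSpace ℝ (Fin n)} {r a : ℝ} {t : ℕ}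
    (h : ∀ σ : List Bool, σ.length = n * t → (cell n σ ∩ Metric.ball z r).Nonempty → M σ ≤ a) :
    μ (Metric.ball z r) ≤
      ENNReal.ofReal a * volume (Metric.ball z (r + n / 2 ^ t) ∩ cell n []) := by
  set A : Set (List Bool) := {σ | σ.length = n * t ∧ (cell n σ ∩ Metric.ball z r).Nonempty}
  have hA : ∀ σ ∈ A, σ.length = n * t := fun σ hσ => hσ.1
  calc μ (Metric.ball z r) = μ (Metric.ball z r ∩ cell n []) :=
        (measure_inter_conull hμ.carried).symm
    _ ≤ μ (⋃ σ ∈ A, cell n σ) := by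
        refine measure_mono fun x hx => ?_
        simp only [Set.mem_iUnion]
        exact ⟨_, ⟨by simp, ⟨x, mem_cell_initialSegment hx.2 (n * t), hx.1⟩⟩,
          mem_cell_initialSegment hx.2 (n * t)⟩
    _ = ∑' σ : A, μ (cell n σ.1) := measure_biUnion_cell μ hA
    _ ≤ ∑' σ : A, ENNReal.ofReal a * volume (cell n σ.1) := by
        refine ENNReal.tsum_le_tsum fun σ => ?_
        rw [hμ.apply_cell σ.1 ⟨t, hA _ σ.2⟩, mul_comm]
        gcongr
        exact h _ σ.2.1 σ.2.2
    _ = ENNReal.ofReal a * volume (⋃ σ ∈ A, cell n σ) := by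
        rw [ENNReal.tsum_mul_left, measure_biUnion_cell volume hA]
    _ ≤ _ := by
        gcongr
        refine Set.iUnion₂_subset fun σ hσ x hx => ⟨?_, cell_subset σ hx⟩
        obtain ⟨hl, y, hy, hyz⟩ := hσ
        have := dist_le_of_mem_cell hl hx hy
        rw [Metric.mem_ball] at hyz ⊢
        linarith [dist_triangle x y z]

/-- Dual to `ball_le`: the cells that meet the shrunken ball stay inside the original one. -/
theorem IsInducedMeasure.le_ball {M : List Bool → ℝ} {μ : Measure (EuclideanSpace ℝ (Fin n))}
    (hμ : IsInducedMeasure M μ) {z : EuclideanSpace ℝ (Fin n)} {r b : ℝ} {t : ℕ}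
    (h : ∀ σ : List Bool, σ.length = n * t → (cell n σ ∩ Metric.ball z r).Nonempty → b ≤ M σ) :
    ENNReal.ofReal b * volume (Metric.ball z (r - n / 2 ^ t) ∩ cell n []) ≤
      μ (Metric.ball z r) := by
  set A : Set (List Bool) :=
    {σ | σ.length = n * t ∧ (cell n σ ∩ Metric.ball z (r - n / 2 ^ t)).Nonempty}
  have hA : ∀ σ ∈ A, σ.length = n * t := fun σ hσ => hσ.1
  calc ENNReal.ofReal b * volume (Metric.ball z (r - n / 2 ^ t) ∩ cell n [])
      ≤ ENNReal.ofReal b * volume (⋃ σ ∈ A, cell n σ) := by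
        gcongr
        intro x hx
        simp only [Set.mem_iUnion]
        exact ⟨_, ⟨by simp, ⟨x, mem_cell_initialSegment hx.2 (n * t), hx.1⟩⟩,
          mem_cell_initialSegment hx.2 (n * t)⟩
    _ = ∑' σ : A, ENNReal.ofReal b * volume (cell n σ.1) := by
        rw [ENNReal.tsum_mul_left, measure_biUnion_cell volume hA]
    _ ≤ ∑' σ : A, μ (cell n σ.1) := by
        refine ENNReal.tsum_le_tsum fun σ => ?_
        rw [hμ.apply_cell σ.1 ⟨t, hA _ σ.2⟩, mul_comm]
        gcongr
        refine h _ σ.2.1 (σ.2.2.mono (Set.inter_subset_inter_right _ (Metric.ball_subset_ball ?_)))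
        linarith [show (0 : ℝ) ≤ n / 2 ^ t by positivity]
    _ = μ (⋃ σ ∈ A, cell n σ) := (measure_biUnion_cell μ hA).symm
    _ ≤ μ (Metric.ball z r) := by
        refine measure_mono (Set.iUnion₂_subset fun σ hσ x hx => ?_)
        obtain ⟨hl, y, hy, hyz⟩ := hσ
        have := dist_le_of_mem_cell hl hx hy
        rw [Metric.mem_ball] at hyz ⊢
        linarith [dist_triangle x y z]

/-- The proportion of the ball `B_r(z)` that lies in the unit cube. -/
noncomputable def cubeRatio (z : EuclideanSpace ℝ (Fin n)) (r : ℝ) : ℝ :=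
  volume.real (Metric.ball z r ∩ cell n []) / volume.real (Metric.ball z r)

theorem volume_real_ball (z : EuclideanSpace ℝ (Fin n)) {r : ℝ} (hr : 0 ≤ r) :
    volume.real (Metric.ball z r) =
      r ^ n * volume.real (Metric.ball (0 : EuclideanSpace ℝ (Fin n)) 1) := by
  rw [measureReal_def, Measure.addHaar_ball _ _ hr, ENNReal.toReal_mul,
    ENNReal.toReal_ofReal (by positivity), finrank_euclideanSpace_fin, measureReal_def]

theorem volume_real_ball_pos {n : ℕ} (z : EuclideanSpace ℝ (Fin n)) {r : ℝ} (hr : 0 < r) :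
    0 < volume.real (Metric.ball z r) :=
  ENNReal.toReal_pos (Metric.measure_ball_pos _ _ hr).ne' measure_ball_lt_top.ne

/-- The cube is convex, so the homothety with centre `z` and ratio `c` maps the left intersection
into the right one. As `c > 0`, the image avoids the missing faces even if `z` lies on one of them.
-/
theorem volume_real_ball_inter_ge {z : EuclideanSpace ℝ (Fin n)}
    (hz : ∀ i, z i ∈ Set.Icc (0 : ℝ) 1) {c : ℝ} (hc : 0 < c) (hc1 : c ≤ 1) (r : ℝ) :
    c ^ n * volume.real (Metric.ball z r ∩ cell n []) ≤
      volume.real (Metric.ball z (c * r) ∩ cell n []) := by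
  have h := Measure.addHaar_image_homothety (volume : Measure (EuclideanSpace ℝ (Fin n))) z c
    (Metric.ball z r ∩ cell n [])
  have hsub : AffineMap.homothety z c '' (Metric.ball z r ∩ cell n []) ⊆
      Metric.ball z (c * r) ∩ cell n [] := by
    rintro _ ⟨x, ⟨hx, hxQ⟩, rfl⟩
    constructor
    · rw [Metric.mem_ball] at hx ⊢
      rw [dist_homothety_center, Real.norm_of_nonneg hc.le, dist_comm]
      exact mul_lt_mul_of_pos_left hx hc
    · rw [mem_cell_nil] at hxQ ⊢
      intro i
      have : (AffineMap.homothety z c x) i = c * (x i - z i) + z i := by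
        simp [AffineMap.homothety_apply]
      rw [this]
      have h1 := hz i
      have h2 := hxQ i
      constructor
      · nlinarith [h1.1, h2.1]
      · nlinarith [h1.2, h2.2]
  have h2 := measureReal_mono (μ := volume) hsub
    (ne_top_of_le_ne_top measure_ball_lt_top.ne (measure_mono Set.inter_subset_left))
  rw [measureReal_def, h, finrank_euclideanSpace_fin, abs_of_pos (by positivity),
    ENNReal.toReal_mul, ENNReal.toReal_ofReal (by positivity)] at h2
  exact h2

/-- Monotonicity gives the ratio a positive limit as `r → 0`, its supremum. This lets boundary
points be treated like interior ones. -/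
theorem cubeRatio_anti {z : EuclideanSpace ℝ (Fin n)} (hz : ∀ i, z i ∈ Set.Icc (0 : ℝ) 1)
    {r s : ℝ} (hr : 0 < r) (hrs : r ≤ s) : cubeRatio z s ≤ cubeRatio z r := by
  have hs := hr.trans_le hrs
  have h := volume_real_ball_inter_ge hz (div_pos hr hs) ((div_le_one hs).2 hrs) s
  rw [div_mul_cancel₀ _ hs.ne'] at h
  unfold cubeRatio
  rw [volume_real_ball z hs.le, volume_real_ball z hr.le]
  have hW := volume_real_ball_pos (0 : EuclideanSpace ℝ (Fin n)) one_pos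
  rw [div_le_div_iff₀ (by positivity) (by positivity)]
  rw [div_pow, div_mul_eq_mul_div, div_le_iff₀ (by positivity)] at h
  nlinarith

theorem cubeRatio_le_one (z : EuclideanSpace ℝ (Fin n)) (r : ℝ) : cubeRatio z r ≤ 1 :=
  div_le_one_of_le₀ (measureReal_mono Set.inter_subset_left measure_ball_lt_top.ne)
    measureReal_nonneg

theorem cubeRatio_pos {z : EuclideanSpace ℝ (Fin n)} (hz : ∀ i, z i ∈ Set.Icc (0 : ℝ) 1)
    {r : ℝ} (hr : 0 < r) : 0 < cubeRatio z r := by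
  -- A ball that contains the whole cube has positive ratio, and smaller radii only increase it.
  have hbig : cell n [] ⊆ Metric.ball z (r + n + 1) := by
    intro x hx
    rw [Metric.mem_ball, EuclideanSpace.dist_eq]
    have h1 : ∑ i, dist (x i) (z i) ^ 2 ≤ ∑ _i : Fin n, (1 : ℝ) := by
      refine Finset.sum_le_sum fun i _ => ?_
      have hx' := mem_cell_nil.1 hx i
      have hz' := hz i
      rw [Real.dist_eq, sq_abs]
      nlinarith [hx'.1, hx'.2, hz'.1, hz'.2]
    have h2 : ∑ _i : Fin n, (1 : ℝ) = n := by simp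
    have h3 : Real.sqrt (∑ i, dist (x i) (z i) ^ 2) ≤ n := by
      rw [Real.sqrt_le_iff]
      refine ⟨by positivity, (h1.trans h2.le).trans ?_⟩
      have : (1 : ℝ) ≤ n := by exact_mod_cast NeZero.one_le
      nlinarith
    linarith
  have hn : (0 : ℝ) ≤ n := by positivity
  refine lt_of_lt_of_le ?_ (cubeRatio_anti hz hr (by linarith : r ≤ r + n + 1))
  unfold cubeRatio
  rw [Set.inter_eq_right.2 hbig, measureReal_def, volume_cell_nil]
  exact div_pos (by simp) (volume_real_ball_pos z (by linarith))

/-- If the averages of `M` over all small cells near `z` oscillate between at most `a` and at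
least `b` at scales tending to `0`, then the Lebesgue derivative of the induced measure at `z`
does not exist. -/
theorem IsInducedMeasure.not_hasLebesgueDerivativeAt {M : List Bool → ℝ}
    {μ : Measure (EuclideanSpace ℝ (Fin n))} (hμ : IsInducedMeasure M μ)
    {z : EuclideanSpace ℝ (Fin n)} (hz : ∀ i, z i ∈ Set.Icc (0 : ℝ) 1) {a b : ℝ} (ha : 0 < a)
    (hab : a < b)
    (hA : ∀ ε > 0, ∃ r : ℝ, 0 < r ∧ r < ε ∧ ∃ t : ℕ, n / 2 ^ t ≤ ε * r ∧
      ∀ σ : List Bool, σ.length = n * t → (cell n σ ∩ Metric.ball z r).Nonempty → M σ ≤ a)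
    (hB : ∀ ε > 0, ∃ r : ℝ, 0 < r ∧ r < ε ∧ ∃ t : ℕ, n / 2 ^ t ≤ ε * r ∧
      ∀ σ : List Bool, σ.length = n * t → (cell n σ ∩ Metric.ball z r).Nonempty → b ≤ M σ) :
    ¬ HasLebesgueDerivativeAt μ z := by
  rintro ⟨l, hl⟩
  have := hμ.prob
  have hbdd : BddAbove (Set.range fun r : Set.Ioi (0 : ℝ) => cubeRatio z r) :=
    ⟨1, by rintro _ ⟨r, rfl⟩; exact cubeRatio_le_one z r⟩
  -- `κ` is the limiting proportion of small balls inside the cube; the derivative would have to be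
  -- both at most `a * κ` and at least `b * κ`.
  set κ := ⨆ r : Set.Ioi (0 : ℝ), cubeRatio z r with hκ
  have hκr : ∀ r, 0 < r → cubeRatio z r ≤ κ := fun r hr => le_ciSup hbdd ⟨r, hr⟩
  have hκ0 : 0 < κ := (cubeRatio_pos hz one_pos).trans_le (hκr 1 one_pos)
  have hratio : ∀ r, 0 < r → μ (Metric.ball z r) / volume (Metric.ball z r) =
      ENNReal.ofReal (μ.real (Metric.ball z r) / volume.real (Metric.ball z r)) := by
    intro r hr
    rw [ENNReal.ofReal_div_of_pos (volume_real_ball_pos z hr), ofReal_measureReal,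
      ofReal_measureReal measure_ball_lt_top.ne]
  have hW := volume_real_ball_pos (0 : EuclideanSpace ℝ (Fin n)) one_pos
  have hfin : ∀ s, volume (Metric.ball z s ∩ cell n []) ≠ ∞ := fun s =>
    ne_top_of_le_ne_top measure_ball_lt_top.ne (measure_mono Set.inter_subset_left)
  have hV : ∀ s, 0 < s → volume.real (Metric.ball z s ∩ cell n []) =
      cubeRatio z s * volume.real (Metric.ball z s) := fun s hs => by
    rw [cubeRatio, div_mul_cancel₀ _ (volume_real_ball_pos z hs).ne']
  have upper : ∀ ε > 0, l ≤ ENNReal.ofReal (a * κ * (1 + ε) ^ n) := by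
    intro ε hε
    refine le_of_tendsto_of_frequently hl ?_
    rw [frequently_nhdsWithin_iff, Metric.nhds_basis_ball.frequently_iff]
    intro δ hδ
    obtain ⟨r, hr, hrε, t, ht, h⟩ := hA (min ε δ) (lt_min hε hδ)
    refine ⟨r, ?_, ?_, hr⟩
    · rw [Metric.mem_ball, Real.dist_eq, sub_zero, abs_of_pos hr]
      exact hrε.trans_le (min_le_right _ _)
    have h1 := hμ.ball_le h
    have h2 := ENNReal.toReal_mono (ENNReal.mul_ne_top ENNReal.ofReal_ne_top (hfin _)) h1
    rw [ENNReal.toReal_mul, ENNReal.toReal_ofReal ha.le, ← measureReal_def, ← measureReal_def] at h2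
    rw [hratio r hr]
    refine ENNReal.ofReal_le_ofReal ?_
    rw [div_le_iff₀ (volume_real_ball_pos z hr)]
    have ht0 : (0 : ℝ) ≤ n / 2 ^ t := by positivity
    have hrt : r + n / 2 ^ t ≤ (1 + ε) * r := by nlinarith [min_le_left ε δ]
    calc μ.real (Metric.ball z r) ≤ _ := h2
      _ ≤ a * volume.real (Metric.ball z ((1 + ε) * r) ∩ cell n []) := by
          gcongr
          exact hfin _
      _ ≤ a * (κ * ((1 + ε) ^ n * volume.real (Metric.ball z r))) := by
          rw [hV _ (by positivity), volume_real_ball z (by positivity : 0 ≤ (1 + ε) * r),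
            volume_real_ball z hr.le, mul_pow, ← mul_assoc ((1 + ε) ^ n)]
          gcongr
          exact hκr _ (by positivity)
      _ = _ := by ring
  have lower : ∀ s > 0, ∀ ε > 0, ε < 1 →
      ENNReal.ofReal (b * cubeRatio z s * (1 - ε) ^ n) ≤ l := by
    intro s hs ε hε hε1
    refine ge_of_tendsto_of_frequently hl ?_
    rw [frequently_nhdsWithin_iff, Metric.nhds_basis_ball.frequently_iff]
    intro δ hδ
    obtain ⟨r, hr, hrε, t, ht, h⟩ := hB (min ε (min δ s)) (lt_min hε (lt_min hδ hs))
    refine ⟨r, ?_, ?_, hr⟩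
    · rw [Metric.mem_ball, Real.dist_eq, sub_zero, abs_of_pos hr]
      exact hrε.trans_le ((min_le_right _ _).trans (min_le_left _ _))
    have hrs : r < s := hrε.trans_le ((min_le_right _ _).trans (min_le_right _ _))
    have h1 := hμ.le_ball h
    have h2 := ENNReal.toReal_mono (measure_ne_top μ _) h1
    rw [ENNReal.toReal_mul, ENNReal.toReal_ofReal (ha.trans hab).le, ← measureReal_def,
      ← measureReal_def] at h2
    rw [hratio r hr]
    refine ENNReal.ofReal_le_ofReal ?_
    rw [le_div_iff₀ (volume_real_ball_pos z hr)]
    have hb := ha.trans hab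
    have h1ε : 0 < 1 - ε := by linarith
    have hrt : (1 - ε) * r ≤ r - n / 2 ^ t := by nlinarith [min_le_left ε (min δ s)]
    calc b * cubeRatio z s * (1 - ε) ^ n * volume.real (Metric.ball z r)
        = b * (cubeRatio z s * ((1 - ε) ^ n * volume.real (Metric.ball z r))) := by ring
      _ ≤ b * volume.real (Metric.ball z ((1 - ε) * r) ∩ cell n []) := by
          rw [hV _ (by positivity), volume_real_ball z (by positivity : 0 ≤ (1 - ε) * r),
            volume_real_ball z hr.le, mul_pow, ← mul_assoc ((1 - ε) ^ n)]
          gcongr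
          exact cubeRatio_anti hz (by positivity) (by nlinarith)
      _ ≤ b * volume.real (Metric.ball z (r - n / 2 ^ t) ∩ cell n []) := by
          gcongr
          exact hfin _
      _ ≤ _ := h2
  -- Let `ε → 0` with `s` fixed; the supremum over `s` then gives `b * κ ≤ a * κ`, which is
  -- impossible as `κ > 0`.
  have key : ∀ s > 0, b * cubeRatio z s ≤ a * κ := by
    intro s hs
    have h1 : Tendsto (fun ε : ℝ => a * κ * (1 + ε) ^ n) (𝓝[>] 0) (𝓝 (a * κ * (1 + 0) ^ n)) :=
      ((by fun_prop : Continuous fun ε : ℝ => a * κ * (1 + ε) ^ n).tendsto 0).mono_left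
        nhdsWithin_le_nhds
    have h2 : Tendsto (fun ε : ℝ => b * cubeRatio z s * (1 - ε) ^ n) (𝓝[>] 0)
        (𝓝 (b * cubeRatio z s * (1 - 0) ^ n)) :=
      ((by fun_prop : Continuous fun ε : ℝ => b * cubeRatio z s * (1 - ε) ^ n).tendsto 0).mono_left
        nhdsWithin_le_nhds
    have h3 := le_of_tendsto_of_tendsto h2 h1 ?_
    · simpa using h3
    · filter_upwards [Ioo_mem_nhdsGT (zero_lt_one' ℝ)] with ε hε
      have h4 := (lower s hs ε hε.1 hε.2).trans (upper ε hε.1)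
      have := hε.1
      exact (ENNReal.ofReal_le_ofReal_iff (by positivity)).1 h4
  have : κ ≤ a * κ / b := by
    have : Nonempty (Set.Ioi (0 : ℝ)) := ⟨⟨1, Set.mem_Ioi.2 one_pos⟩⟩
    refine ciSup_le fun r => ?_
    rw [le_div_iff₀ (ha.trans hab), mul_comm]
    exact key r r.2
  rw [le_div_iff₀ (ha.trans hab)] at this
  nlinarith

end

/-! ### Computability of recursively defined strategies -/

/-- Recursion along a string: the state after `σ ++ [b]` is computed from `σ`, the state after `σ`,
and `b`. -/
def stringRec {S : Type*} (F : List Bool → S → Bool → S) (s₀ : S) (σ : List Bool) : S :=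
  (σ.foldl (fun q b => (q.1 ++ [b], F q.1 q.2 b)) (([] : List Bool), s₀)).2

@[simp]
theorem stringRec_nil {S : Type*} (F : List Bool → S → Bool → S) (s₀ : S) :
    stringRec F s₀ [] = s₀ := rfl

@[simp]
theorem stringRec_append {S : Type*} (F : List Bool → S → Bool → S) (s₀ : S) (σ : List Bool)
    (b : Bool) : stringRec F s₀ (σ ++ [b]) = F σ (stringRec F s₀ σ) b := by
  have h : ∀ τ : List Bool, (τ.foldl (fun q b => (q.1 ++ [b], F q.1 q.2 b))
      (([] : List Bool), s₀)).1 = τ := by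
    intro τ
    induction τ using List.reverseRecOn with
    | nil => rfl
    | append_singleton τ b ih => rw [List.foldl_append]; simp [ih]
  simp [stringRec, List.foldl_append, h]

theorem computable_stringRec {S : Type*} [Primcodable S] {F : List Bool → S → Bool → S}
    (hF : Computable fun q : List Bool × S × Bool => F q.1 q.2.1 q.2.2) (s₀ : S) :
    Computable (stringRec F s₀) := by
  let f : List Bool × S → Bool → List Bool × S := fun q b => (q.1 ++ [b], F q.1 q.2 b)
  -- The fold over the first `k` bits, written as a recursion on `k` so that `Computable.nat_rec`
  -- applies.
  let g : List Bool → ℕ → List Bool × S := fun σ k =>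
    Nat.rec ([], s₀) (fun k q => Option.casesOn (σ[k]?) q (fun b => f q b)) k
  have hg : ∀ σ k, g σ k = (σ.take k).foldl f ([], s₀) := by
    intro σ k
    induction k with
    | zero => simp [g]
    | succ k ih =>
      have : g σ (k + 1) = Option.casesOn (σ[k]?) (g σ k) (fun b => f (g σ k) b) := rfl
      rw [this, ih, List.take_add_one, List.foldl_append]
      cases σ[k]? <;> simp
  have hf : Computable₂ f := by
    have h1 : Computable fun q : (List Bool × S) × Bool => q.1.1 ++ [q.2] :=
      Computable.list_concat.comp (Computable.fst.comp Computable.fst) Computable.snd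
    refine Computable.pair h1 ?_
    have h2 : Computable fun q : (List Bool × S) × Bool => (q.1.1, q.1.2, q.2) :=
      Computable.pair (Computable.fst.comp Computable.fst)
        (Computable.pair (Computable.snd.comp Computable.fst) Computable.snd)
    exact hF.comp h2
  have hstep : Computable₂ fun (σ : List Bool) (q : ℕ × (List Bool × S)) =>
      (Option.casesOn (σ[q.1]?) q.2 (fun b => f q.2 b) : List Bool × S) := by
    refine Computable.option_casesOn ?_ (Computable.snd.comp Computable.snd) ?_
    · exact Computable.list_getElem?.comp Computable.fst (Computable.fst.comp Computable.snd)
    · exact hf.comp (Computable.snd.comp (Computable.snd.comp Computable.fst)) Computable.snd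
  have hgc : Computable fun σ : List Bool => g σ σ.length :=
    Computable.nat_rec Computable.list_length (Computable.const _) hstep
  have : stringRec F s₀ = fun σ => (g σ σ.length).2 := by
    funext σ
    rw [hg, List.take_length]
    rfl
  rw [this]
  exact Computable.snd.comp hgc

theorem primrec_pow : Primrec₂ fun a b : ℕ => a ^ b :=
  Primrec₂.unpaired'.1 Nat.Primrec.pow

theorem isComputableFun_div {f : List Bool → ℝ} {p q : List Bool → ℕ} (hp : Computable p)
    (hq : Computable q) (hq0 : ∀ σ, 0 < q σ) (h : ∀ σ, f σ = p σ / q σ) : IsComputableFun f := by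
  refine ⟨fun σ k => p σ * 2 ^ k / q σ, ?_, fun σ k => ?_⟩
  · refine (Primrec.nat_div.to_comp).comp ?_ (hq.comp Computable.fst)
    exact (Primrec.nat_mul.to_comp).comp (hp.comp Computable.fst)
      (primrec_pow.to_comp.comp (Computable.const 2) Computable.snd)
  · have hq' : (0 : ℝ) < q σ := by exact_mod_cast hq0 σ
    have h1 : ((p σ * 2 ^ k / q σ : ℕ) : ℝ) ≤ p σ * 2 ^ k / q σ := by
      have := @Nat.cast_div_le ℝ _ _ _ (p σ * 2 ^ k) (q σ)
      push_cast at this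
      exact this
    have h2 : (p σ * 2 ^ k / q σ : ℝ) < ((p σ * 2 ^ k / q σ : ℕ) : ℝ) + 1 := by
      rw [div_lt_iff₀ hq']
      have := Nat.lt_mul_div_succ (p σ * 2 ^ k) (hq0 σ)
      rw [mul_comm (q σ)] at this
      exact_mod_cast this
    have h3 : f σ = (p σ * 2 ^ k / q σ) / 2 ^ k := by rw [h]; field_simp
    rw [h3, ← sub_div, abs_div, abs_of_pos (by positivity : (0 : ℝ) < 2 ^ k)]
    gcongr
    rw [abs_le]
    constructor <;> linarith

/-! ### Single bets with integer capital -/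

/-- Stake `s` on a favourable outcome (`w = true`) starting from the capital `x`, where the stake is
reduced so that the capital does not exceed the target `t`. -/
def betUp (x t s : ℕ) (w : Bool) : ℕ := if w then x + min s (t - x) else x - min s (t - x)

/-- The bet opposite to `betUp`: the capital decreases to the target `t` if `w = true`. -/
def betDown (x t s : ℕ) (w : Bool) : ℕ := if w then x - min s (x - t) else x + min s (x - t)

/-- The hypothesis keeps the stake at most `x`, so that the truncated subtraction is exact. For
`betDown` this is automatic. -/
theorem betUp_fair {x t : ℕ} (h : t ≤ 2 * x) (s : ℕ) (w : Bool) :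
    betUp x t s w + betUp x t s (!w) = 2 * x := by
  cases w <;> simp [betUp] <;> omega

theorem betDown_fair (x t s : ℕ) (w : Bool) :
    betDown x t s w + betDown x t s (!w) = 2 * x := by
  cases w <;> simp [betDown] <;> omega

/-- In real units this is what the invariants need: no overshooting, no bet at the target, and
cutting the stake matters only if the target is reached anyway. -/
theorem betUp_spec {x t s : ℕ} {w : Bool} {S X T s' : ℝ} (hS : 0 < S)
    (hx : (x : ℝ) = X * S) (ht : (t : ℝ) = T * S) (hs : (s : ℝ) = s' * S) :
    betUp x t s w / S ≤ max X T ∧ (T ≤ X → betUp x t s w / S = X) ∧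
      (T ≤ betUp x t s w / S ∨ X + (if w then s' else -s') ≤ betUp x t s w / S) := by
  have h1 : betUp x t s w ≤ max x t := by
    cases w
    · simp [betUp]
    · simp [betUp]; omega
  have h2 : t ≤ x → betUp x t s w = x := by
    intro h; cases w <;> simp [betUp, Nat.sub_eq_zero_of_le h]
  have h3 : t ≤ betUp x t s w ∨ (x : ℤ) + (if w then (s : ℤ) else -s) ≤ betUp x t s w := by
    cases w <;> simp [betUp] <;> omega
  refine ⟨?_, fun h => ?_, ?_⟩
  · rw [div_le_iff₀ hS, max_mul_of_nonneg _ _ hS.le, ← hx, ← ht]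
    exact_mod_cast h1
  · rw [h2, hx, mul_div_cancel_right₀ _ hS.ne']
    have : (t : ℝ) ≤ x := by rw [ht, hx]; exact mul_le_mul_of_nonneg_right h hS.le
    exact_mod_cast this
  · rw [le_div_iff₀ hS, le_div_iff₀ hS, ← ht]
    refine h3.imp (fun h => by exact_mod_cast h) fun h => ?_
    have h' : (x : ℝ) + (if w then (s : ℝ) else -s) ≤ betUp x t s w := by
      cases w
      · simp only [Bool.false_eq_true, if_false] at h ⊢; exact_mod_cast h
      · simp only [if_true] at h ⊢; exact_mod_cast h
    rw [hx, hs] at h'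
    refine le_trans (le_of_eq ?_) h'
    cases w <;> simp <;> ring

theorem betDown_spec {x t s : ℕ} {w : Bool} {S X T s' : ℝ} (hS : 0 < S)
    (hx : (x : ℝ) = X * S) (ht : (t : ℝ) = T * S) (hs : (s : ℝ) = s' * S) :
    min X T ≤ betDown x t s w / S ∧ (X ≤ T → betDown x t s w / S = X) ∧
      (betDown x t s w / S ≤ T ∨ betDown x t s w / S ≤ X - (if w then s' else -s')) := by
  have h1 : min x t ≤ betDown x t s w := by
    cases w
    · simp [betDown]
    · simp [betDown]; omega
  have h2 : x ≤ t → betDown x t s w = x := by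
    intro h; cases w <;> simp [betDown, Nat.sub_eq_zero_of_le h]
  have h3 : betDown x t s w ≤ t ∨ (betDown x t s w : ℤ) ≤ x - (if w then (s : ℤ) else -s) := by
    cases w <;> simp [betDown] <;> omega
  refine ⟨?_, fun h => ?_, ?_⟩
  · rw [le_div_iff₀ hS, min_mul_of_nonneg _ _ hS.le, ← hx, ← ht]
    exact_mod_cast h1
  · rw [h2, hx, mul_div_cancel_right₀ _ hS.ne']
    have : (x : ℝ) ≤ t := by rw [ht, hx]; exact mul_le_mul_of_nonneg_right h hS.le
    exact_mod_cast this
  · rw [div_le_iff₀ hS, div_le_iff₀ hS, ← ht]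
    refine h3.imp (fun h => by exact_mod_cast h) fun h => ?_
    have h' : (betDown x t s w : ℝ) ≤ x - (if w then (s : ℝ) else -s) := by
      cases w
      · simp only [Bool.false_eq_true, if_false] at h ⊢; exact_mod_cast h
      · simp only [if_true] at h ⊢; exact_mod_cast h
    rw [hx, hs] at h'
    refine le_trans h' (le_of_eq ?_)
    cases w <;> simp <;> ring

theorem primrec_bet {α : Type*} [Primcodable α] {x t s : α → ℕ} {w : α → Bool} (hx : Primrec x)
    (ht : Primrec t) (hs : Primrec s) (hw : Primrec w) :
    Primrec (fun q => betUp (x q) (t q) (s q) (w q)) ∧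
      Primrec (fun q => betDown (x q) (t q) (s q) (w q)) := by
  have hw' : PrimrecPred fun q => w q = true := Primrec.eq.comp hw (Primrec.const true)
  have h1 := Primrec.nat_min.comp hs (Primrec.nat_sub.comp ht hx)
  have h2 := Primrec.nat_min.comp hs (Primrec.nat_sub.comp hx ht)
  exact ⟨Primrec.ite hw' (Primrec.nat_add.comp hx h1) (Primrec.nat_sub.comp hx h1),
    Primrec.ite hw' (Primrec.nat_sub.comp hx h2) (Primrec.nat_add.comp hx h2)⟩

theorem IsMartingale.append_le {d : List Bool → ℝ} (hd : IsMartingale d) (σ : List Bool)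
    (b : Bool) : d (σ ++ [b]) ≤ 2 * d σ := by
  have h := hd.fair σ
  have h0 := hd.nonneg (σ ++ [false])
  have h1 := hd.nonneg (σ ++ [true])
  cases b <;> linarith

theorem IsMartingale.le_pow {d : List Bool → ℝ} (hd : IsMartingale d) (σ : List Bool) :
    d σ ≤ 2 ^ σ.length * d [] := by
  induction σ using List.reverseRecOn with
  | nil => simp
  | append_singleton σ b ih =>
    have := hd.append_le σ b
    rw [List.length_append, List.length_singleton, pow_succ]
    linarith

/-! ### The strategy that oscillates along a sequence on which `d` succeeds -/

/-! The states of the oscillating strategy are quadruples: the capital (scaled by `4 ^ p * 2 ^ c`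
after `p` bits), the number of the phase, the length at which the phase began, and the next length
at which the phase may change. Phases `0, 1` modulo `4` aim for the capital `5 / 4`, phases `2, 3`
for `3 / 4`. -/

/-- The current target is reached. -/
def AtTarget (c p : ℕ) (q : ℕ × ℕ × ℕ × ℕ) : Prop :=
  (q.2.1 % 4 < 2 ∧ 5 * (4 ^ p * 2 ^ c) ≤ 4 * q.1) ∨
    (¬ q.2.1 % 4 < 2 ∧ 4 * q.1 ≤ 3 * (4 ^ p * 2 ^ c))

instance (c p : ℕ) (q : ℕ × ℕ × ℕ × ℕ) : Decidable (AtTarget c p q) := by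
  unfold AtTarget; infer_instance

/-- Move on to the next phase, if it is time and the target is reached. -/
def oscCheck (c p : ℕ) (q : ℕ × ℕ × ℕ × ℕ) : ℕ × ℕ × ℕ × ℕ :=
  if p = q.2.2.2 then
    if AtTarget c p q then (q.1, q.2.1 + 1, p, 16 * q.2.2.2)
    else (q.1, q.2.1, q.2.2.1, 16 * q.2.2.2)
  else q

/-- Bet on the next bit, following (in phases `0, 1`) or opposing (in phases `2, 3`) the strategy
whose capital changes by about `(u - v) / 2 ^ (p + 3)` if the bit is `true`. -/
def oscBet (c p u v : ℕ) (q : ℕ × ℕ × ℕ × ℕ) (b : Bool) : ℕ × ℕ × ℕ × ℕ :=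
  -- The new unit is `4 ^ (p + 1) * 2 ^ c`, hence the factor `4`, and the targets stand for `5 / 4`
  -- and `3 / 4`. For `c = m + 3` and a phase begun at `T`, the exponent `p + 2 - T` makes the stake
  -- `2 ^ (-(T + m))` times the approximate change of `d`.
  (if q.2.1 % 4 < 2 then
    betUp (4 * q.1) (5 * (4 ^ p * 2 ^ c)) ((u - v + (v - u)) * 2 ^ (p + 2 - q.2.2.1))
      (b == decide (v ≤ u))
  else
    betDown (4 * q.1) (3 * (4 ^ p * 2 ^ c)) ((u - v + (v - u)) * 2 ^ (p + 2 - q.2.2.1))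
      (b == decide (v ≤ u)), q.2)

/-- The strategy determined by approximations `a` of a martingale. -/
def oscState (n c : ℕ) (a : List Bool → ℕ → ℕ) : List Bool → ℕ × ℕ × ℕ × ℕ :=
  stringRec (fun σ q b => oscBet c σ.length (a (σ ++ [true]) (σ.length + 3)) (a σ (σ.length + 3))
    (oscCheck c σ.length q) b) (2 ^ c, 0, 0, n)

theorem primrecPred_atTarget (c : ℕ) :
    PrimrecPred fun q : ℕ × (ℕ × ℕ × ℕ × ℕ) => AtTarget c q.1 q.2 := by
  have hsc : Primrec fun q : ℕ × (ℕ × ℕ × ℕ × ℕ) => 4 ^ q.1 * 2 ^ c :=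
    Primrec.nat_mul.comp (primrec_pow.comp (Primrec.const 4) Primrec.fst) (Primrec.const _)
  have hN : Primrec fun q : ℕ × (ℕ × ℕ × ℕ × ℕ) => 4 * q.2.1 :=
    Primrec.nat_mul.comp (Primrec.const 4) (Primrec.fst.comp Primrec.snd)
  have hup : PrimrecPred fun q : ℕ × (ℕ × ℕ × ℕ × ℕ) => q.2.2.1 % 4 < 2 :=
    Primrec.nat_lt.comp (Primrec.nat_mod.comp
      (Primrec.fst.comp (Primrec.snd.comp Primrec.snd)) (Primrec.const 4)) (Primrec.const 2)
  exact (hup.and (Primrec.nat_le.comp (Primrec.nat_mul.comp (Primrec.const 5) hsc) hN)).or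
    (hup.not.and (Primrec.nat_le.comp hN (Primrec.nat_mul.comp (Primrec.const 3) hsc)))

theorem primrec_oscCheck (c : ℕ) : Primrec₂ (oscCheck c) := by
  have h2 : Primrec fun q : ℕ × (ℕ × ℕ × ℕ × ℕ) => q.2 := Primrec.snd
  have hQ : Primrec fun q : ℕ × (ℕ × ℕ × ℕ × ℕ) => q.2.2.2.2 :=
    Primrec.snd.comp (Primrec.snd.comp (Primrec.snd.comp h2))
  have hQ' : Primrec fun q : ℕ × (ℕ × ℕ × ℕ × ℕ) => 16 * q.2.2.2.2 :=
    Primrec.nat_mul.comp (Primrec.const 16) hQ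
  have hN : Primrec fun q : ℕ × (ℕ × ℕ × ℕ × ℕ) => q.2.1 := Primrec.fst.comp h2
  have hph : Primrec fun q : ℕ × (ℕ × ℕ × ℕ × ℕ) => q.2.2.1 :=
    Primrec.fst.comp (Primrec.snd.comp h2)
  have hT : Primrec fun q : ℕ × (ℕ × ℕ × ℕ × ℕ) => q.2.2.2.1 :=
    Primrec.fst.comp (Primrec.snd.comp (Primrec.snd.comp h2))
  exact Primrec.ite (Primrec.eq.comp Primrec.fst hQ)
    (Primrec.ite (primrecPred_atTarget c)
      (hN.pair ((Primrec.succ.comp hph).pair (Primrec.fst.pair hQ')))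
      (hN.pair (hph.pair (hT.pair hQ')))) h2

theorem primrec_oscBet (c : ℕ) : Primrec fun r : (ℕ × ℕ × ℕ) × (ℕ × ℕ × ℕ × ℕ) × Bool =>
    oscBet c r.1.1 r.1.2.1 r.1.2.2 r.2.1 r.2.2 := by
  have hp : Primrec fun r : (ℕ × ℕ × ℕ) × (ℕ × ℕ × ℕ × ℕ) × Bool => r.1.1 :=
    Primrec.fst.comp Primrec.fst
  have hu : Primrec fun r : (ℕ × ℕ × ℕ) × (ℕ × ℕ × ℕ × ℕ) × Bool => r.1.2.1 :=
    Primrec.fst.comp (Primrec.snd.comp Primrec.fst)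
  have hv : Primrec fun r : (ℕ × ℕ × ℕ) × (ℕ × ℕ × ℕ × ℕ) × Bool => r.1.2.2 :=
    Primrec.snd.comp (Primrec.snd.comp Primrec.fst)
  have hq : Primrec fun r : (ℕ × ℕ × ℕ) × (ℕ × ℕ × ℕ × ℕ) × Bool => r.2.1 :=
    Primrec.fst.comp Primrec.snd
  have hb : Primrec fun r : (ℕ × ℕ × ℕ) × (ℕ × ℕ × ℕ × ℕ) × Bool => r.2.2 :=
    Primrec.snd.comp Primrec.snd
  have hx := Primrec.nat_mul.comp (Primrec.const 4) (Primrec.fst.comp hq)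
  have hsc := Primrec.nat_mul.comp (primrec_pow.comp (Primrec.const 4) hp)
    (Primrec.const (2 ^ c))
  have hs := Primrec.nat_mul.comp
    (Primrec.nat_add.comp (Primrec.nat_sub.comp hu hv) (Primrec.nat_sub.comp hv hu))
    (primrec_pow.comp (Primrec.const 2) (Primrec.nat_sub.comp
      (Primrec.nat_add.comp hp (Primrec.const 2))
      (Primrec.fst.comp (Primrec.snd.comp (Primrec.snd.comp hq)))))
  have hw := Primrec.beq.comp hb (Primrec.nat_le.comp hv hu).decide
  refine Primrec.pair (Primrec.ite ?_
    (primrec_bet hx (Primrec.nat_mul.comp (Primrec.const 5) hsc) hs hw).1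
    (primrec_bet hx (Primrec.nat_mul.comp (Primrec.const 3) hsc) hs hw).2)
    (Primrec.snd.comp hq)
  exact Primrec.nat_lt.comp (Primrec.nat_mod.comp
    (Primrec.fst.comp (Primrec.snd.comp hq)) (Primrec.const 4)) (Primrec.const 2)

theorem computable_betting {S : Type*} [Primcodable S] {B : ℕ → ℕ → ℕ → S → Bool → S}
    (hB : Primrec fun r : (ℕ × ℕ × ℕ) × S × Bool => B r.1.1 r.1.2.1 r.1.2.2 r.2.1 r.2.2)
    {K : ℕ → S → S} (hK : Primrec₂ K) {a : List Bool → ℕ → ℕ} (ha : Computable₂ a) (s₀ : S) :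
    Computable (stringRec (fun σ q b => B σ.length (a (σ ++ [true]) (σ.length + 3))
      (a σ (σ.length + 3)) (K σ.length q) b) s₀) := by
  have hl : Computable fun q : List Bool × S × Bool => q.1.length :=
    Computable.list_length.comp Computable.fst
  have hl3 : Computable fun q : List Bool × S × Bool => q.1.length + 3 :=
    (Primrec.nat_add.comp Primrec.id (Primrec.const 3)).to_comp.comp hl
  have h1 : Computable fun q : List Bool × S × Bool => a (q.1 ++ [true]) (q.1.length + 3) :=
    ha.comp (Computable.list_concat.comp Computable.fst (Computable.const true)) hl3
  have h2 : Computable fun q : List Bool × S × Bool => a q.1 (q.1.length + 3) :=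
    ha.comp Computable.fst hl3
  have h3 : Computable fun q : List Bool × S × Bool => K q.1.length q.2.1 :=
    hK.to_comp.comp hl (Computable.fst.comp Computable.snd)
  have h4 : Computable fun q : List Bool × S × Bool => q.2.2 := Computable.snd.comp Computable.snd
  exact computable_stringRec (Computable.comp hB.to_comp
    (Computable.pair (Computable.pair hl (Computable.pair h1 h2)) (Computable.pair h3 h4))) s₀

theorem computable_oscState (n c : ℕ) {a : List Bool → ℕ → ℕ} (ha : Computable₂ a) :
    Computable (oscState n c a) :=
  computable_betting (primrec_oscBet c) (primrec_oscCheck c) ha _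

/-- The capital in a state after `p` bits. -/
noncomputable def oscCapital (m p : ℕ) (q : ℕ × ℕ × ℕ × ℕ) : ℝ := q.1 / (4 ^ p * 2 ^ (m + 3))

theorem atTarget_iff {m p : ℕ} {q : ℕ × ℕ × ℕ × ℕ} : AtTarget (m + 3) p q ↔
    (q.2.1 % 4 < 2 ∧ 5 / 4 ≤ oscCapital m p q) ∨
      (¬ q.2.1 % 4 < 2 ∧ oscCapital m p q ≤ 3 / 4) := by
  have h1 : 5 * (4 ^ p * 2 ^ (m + 3)) ≤ 4 * q.1 ↔ 5 / 4 ≤ oscCapital m p q := by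
    rw [oscCapital, div_le_div_iff₀ (by norm_num) (by positivity), mul_comm (q.1 : ℝ)]
    exact_mod_cast Iff.rfl
  have h2 : 4 * q.1 ≤ 3 * (4 ^ p * 2 ^ (m + 3)) ↔ oscCapital m p q ≤ 3 / 4 := by
    rw [oscCapital, div_le_div_iff₀ (by positivity) (by norm_num), mul_comm (q.1 : ℝ)]
    exact_mod_cast Iff.rfl
  rw [AtTarget, h1, h2]

/-- The invariant of the strategy: `y` is the capital of the followed martingale. -/
structure OscInv (m : ℕ) (y : ℝ) (p : ℕ) (q : ℕ × ℕ × ℕ × ℕ) : Prop where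
  le : q.2.2.1 ≤ p
  -- The term `1 / 2 ^ (p + 1)` is a reserve against all later errors in the approximation of `d`.
  -- The scale `2 ^ (-(T + m))` is fixed during a phase.
  up : q.2.1 % 4 < 2 → oscCapital m p q ≤ 5 / 4 ∧ (oscCapital m p q = 5 / 4 ∨
    5 / 8 + 1 / 2 ^ (q.2.2.1 + m) * (y + 1 / 2 ^ (p + 1)) ≤ oscCapital m p q)
  down : ¬ q.2.1 % 4 < 2 → 3 / 4 ≤ oscCapital m p q ∧ (oscCapital m p q = 3 / 4 ∨
    oscCapital m p q ≤ 11 / 8 - 1 / 2 ^ (q.2.2.1 + m) * (y + 1 / 2 ^ (p + 1)))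

theorem OscInv.bounds {m : ℕ} {y : ℝ} {p : ℕ} {q : ℕ × ℕ × ℕ × ℕ} (h : OscInv m y p q)
    (hy : 0 ≤ y) : 5 / 8 ≤ oscCapital m p q ∧ oscCapital m p q ≤ 11 / 8 := by
  have h0 : 0 ≤ 1 / 2 ^ (q.2.2.1 + m) * (y + 1 / 2 ^ (p + 1)) := by positivity
  by_cases hu : q.2.1 % 4 < 2
  · obtain ⟨h1, h2⟩ := h.up hu
    rcases h2 with h2 | h2 <;> constructor <;> linarith
  · obtain ⟨h1, h2⟩ := h.down hu
    rcases h2 with h2 | h2 <;> constructor <;> linarith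

/-- A martingale at most doubles with each bit. So a copy scaled according to the length at which
the phase begins fits into the gap `1 / 8` between `5 / 8` and `3 / 4`, or between `5 / 4` and `11 /
8`. -/
theorem phase_small {m p : ℕ} {y : ℝ} (hy : y ≤ 2 ^ p * (2 ^ m / 16)) (hm : 4 ≤ m) :
    1 / 2 ^ (p + m) * (y + 1 / 2 ^ (p + 1)) ≤ 1 / 8 := by
  have h1 : (1 : ℝ) / 2 ^ (p + 1) ≤ 1 := by
    rw [div_le_one (by positivity)]; exact one_le_pow₀ (by norm_num)
  have h2 : (16 : ℝ) ≤ 2 ^ p * 2 ^ m := by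
    calc (16 : ℝ) = 1 * 2 ^ 4 := by norm_num
      _ ≤ 2 ^ p * 2 ^ m := by
        gcongr
        · exact one_le_pow₀ (by norm_num)
        · norm_num
  rw [div_mul_eq_mul_div, one_mul, div_le_iff₀ (by positivity), pow_add 2 p m]
  nlinarith

theorem OscInv.check {m : ℕ} {y : ℝ} {p : ℕ} {q : ℕ × ℕ × ℕ × ℕ} (h : OscInv m y p q)
    (hy : y ≤ 2 ^ p * (2 ^ m / 16)) (hm : 4 ≤ m) :
    OscInv m y p (oscCheck (m + 3) p q) := by
  unfold oscCheck
  split_ifs with h1 h2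
  · have hs := phase_small hy hm
    rw [atTarget_iff] at h2
    have hcap : oscCapital m p (q.1, q.2.1 + 1, p, 16 * q.2.2.2) = oscCapital m p q := rfl
    rcases h2 with ⟨h2, h3⟩ | ⟨h2, h3⟩
    -- At the target the capital is exact, so the invariant of the next phase holds whether or not
    -- the direction is reversed.
    · have h4 : oscCapital m p q = 5 / 4 := le_antisymm (h.up h2).1 h3
      refine ⟨le_rfl, fun _ => ?_, fun _ => ?_⟩
      · rw [hcap, h4]; exact ⟨le_rfl, Or.inl rfl⟩
      · rw [hcap, h4]; exact ⟨by norm_num, Or.inr (by simp only; linarith)⟩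
    · have h4 : oscCapital m p q = 3 / 4 := le_antisymm h3 (h.down h2).1
      refine ⟨le_rfl, fun _ => ?_, fun _ => ?_⟩
      · rw [hcap, h4]; exact ⟨by norm_num, Or.inr (by simp only; linarith)⟩
      · rw [hcap, h4]; exact ⟨le_rfl, Or.inl rfl⟩
  · exact ⟨h.le, h.up, h.down⟩
  · exact h

theorem oscCapital_bet (m p u v : ℕ) (q : ℕ × ℕ × ℕ × ℕ) (b : Bool) :
    oscCapital m (p + 1) (oscBet (m + 3) p u v q b) =
      (if q.2.1 % 4 < 2 then
        (betUp (4 * q.1) (5 * (4 ^ p * 2 ^ (m + 3))) ((u - v + (v - u)) * 2 ^ (p + 2 - q.2.2.1))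
          (b == decide (v ≤ u)) : ℝ)
      else
        (betDown (4 * q.1) (3 * (4 ^ p * 2 ^ (m + 3)))
          ((u - v + (v - u)) * 2 ^ (p + 2 - q.2.2.1)) (b == decide (v ≤ u)) : ℝ)) /
        (4 ^ (p + 1) * 2 ^ (m + 3)) := by
  unfold oscCapital oscBet
  split_ifs <;> rfl

theorem oscBet_fair {m : ℕ} {y : ℝ} {p : ℕ} {q : ℕ × ℕ × ℕ × ℕ} (h : OscInv m y p q)
    (hy : 0 ≤ y) (u v : ℕ) :
    oscCapital m (p + 1) (oscBet (m + 3) p u v q false) +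
      oscCapital m (p + 1) (oscBet (m + 3) p u v q true) = 2 * oscCapital m p q := by
  have hb := (h.bounds hy).1
  have hx : 5 * (4 ^ p * 2 ^ (m + 3)) ≤ 2 * (4 * q.1) := by
    rw [oscCapital, div_le_div_iff₀ (by norm_num) (by positivity), mul_comm (q.1 : ℝ)] at hb
    have : 5 * (4 ^ p * 2 ^ (m + 3)) ≤ 8 * q.1 := by exact_mod_cast hb
    omega
  have e : ∀ A B : ℕ, A + B = 2 * (4 * q.1) → (A : ℝ) / (4 ^ (p + 1) * 2 ^ (m + 3)) +
      B / (4 ^ (p + 1) * 2 ^ (m + 3)) = 2 * oscCapital m p q := by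
    intro A B hAB
    have : (A : ℝ) + B = 2 * (4 * q.1) := by exact_mod_cast hAB
    rw [← add_div, this, oscCapital, pow_succ]
    field_simp
  have hd : (false == decide (v ≤ u)) = !(true == decide (v ≤ u)) := by
    cases decide (v ≤ u) <;> rfl
  rw [oscCapital_bet, oscCapital_bet]
  split_ifs
  · refine e _ _ ?_
    rw [hd, add_comm]
    exact betUp_fair hx _ _
  · refine e _ _ ?_
    rw [hd, add_comm]
    exact betDown_fair _ _ _ _

/-- The two facts about a single bet: it preserves the invariant, and nothing is bet at the
target. -/
theorem OscInv.bet {m : ℕ} {y y' : ℝ} {p u v : ℕ} {q : ℕ × ℕ × ℕ × ℕ} {b : Bool}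
    (h : OscInv m y p q)
    (hyy : |(if b then y' - y else y - y') - ((u : ℝ) - v) / 2 ^ (p + 3)| ≤ 1 / 2 ^ (p + 2)) :
    OscInv m y' (p + 1) (oscBet (m + 3) p u v q b) ∧
      (AtTarget (m + 3) p q →
        oscCapital m (p + 1) (oscBet (m + 3) p u v q b) = oscCapital m p q) := by
  have hT := h.le
  set S : ℝ := 4 ^ (p + 1) * 2 ^ (m + 3) with hS
  have hS0 : 0 < S := by positivity
  set α : ℝ := 1 / 2 ^ (q.2.2.1 + m) with hα
  have hα0 : 0 < α := by positivity
  set X := oscCapital m p q with hX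
  have hx : ((4 * q.1 : ℕ) : ℝ) = X * S := by
    rw [hX, hS, oscCapital, pow_succ 4 p]; push_cast; field_simp
  have ht5 : ((5 * (4 ^ p * 2 ^ (m + 3)) : ℕ) : ℝ) = 5 / 4 * S := by
    rw [hS, pow_succ]; push_cast; ring
  have ht3 : ((3 * (4 ^ p * 2 ^ (m + 3)) : ℕ) : ℝ) = 3 / 4 * S := by
    rw [hS, pow_succ]; push_cast; ring
  have habs : ((u - v + (v - u) : ℕ) : ℝ) = |(u : ℝ) - v| := by
    rcases le_total u v with hl | hl
    · rw [Nat.sub_eq_zero_of_le hl, zero_add, Nat.cast_sub hl, abs_of_nonpos (by simpa using hl)]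
      ring
    · rw [Nat.sub_eq_zero_of_le hl, add_zero, Nat.cast_sub hl, abs_of_nonneg (by simpa using hl)]
  have hs : (((u - v + (v - u)) * 2 ^ (p + 2 - q.2.2.1) : ℕ) : ℝ) =
      (α * (|(u : ℝ) - v| / 2 ^ (p + 3))) * S := by
    rw [Nat.cast_mul, habs, hα, hS]
    have e1 : (2 : ℝ) ^ (p + 2) = 2 ^ (p + 2 - q.2.2.1) * 2 ^ q.2.2.1 := by
      rw [← pow_add]; congr 1; omega
    have e2 : (4 : ℝ) ^ (p + 1) = 2 ^ (p + 2) * 2 ^ p := by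
      rw [show (4 : ℝ) = 2 ^ 2 by norm_num, ← pow_mul, ← pow_add]; congr 1; omega
    push_cast
    rw [e2, e1, pow_add, pow_add, pow_add]
    field_simp
  have hsign : (if (b == decide (v ≤ u)) then α * (|(u : ℝ) - v| / 2 ^ (p + 3))
      else -(α * (|(u : ℝ) - v| / 2 ^ (p + 3)))) =
      α * ((if b then 1 else -1) * (((u : ℝ) - v) / 2 ^ (p + 3))) := by
    by_cases hl : v ≤ u
    · rw [abs_of_nonneg (by simpa using hl)]
      cases b <;> simp [hl]
    · have hl' : (u : ℝ) - v ≤ 0 := by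
        have : u ≤ v := by omega
        simpa using this
      rw [abs_of_nonpos hl']
      cases b <;> simp [hl] <;> ring
  have hdiff : |(y' - y) - (if b then 1 else -1) * (((u : ℝ) - v) / 2 ^ (p + 3))| ≤
      1 / 2 ^ (p + 2) := by
    cases b
    · rw [← abs_neg]
      simp only [Bool.false_eq_true, if_false] at hyy ⊢
      convert hyy using 2
      ring
    · simpa using hyy
  rw [abs_le] at hdiff
  set D := (if b then (1 : ℝ) else -1) * (((u : ℝ) - v) / 2 ^ (p + 3))
  -- Half of the reserve pays for the error of this step, the other half is the next reserve.
  have hpow : (1 : ℝ) / 2 ^ (p + 1) = 1 / 2 ^ (p + 2) + 1 / 2 ^ (p + 2) := by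
    rw [pow_succ 2 (p + 1)]; field_simp; norm_num
  have hcap := oscCapital_bet m p u v q b
  have hT' : (oscBet (m + 3) p u v q b).2 = q.2 := rfl
  by_cases hu : q.2.1 % 4 < 2
  · rw [if_pos hu] at hcap
    obtain ⟨f1, f2, f3⟩ := betUp_spec (w := (b == decide (v ≤ u))) hS0 hx ht5 hs
    rw [← hcap, hsign] at f3
    rw [← hcap] at f1 f2
    obtain ⟨i1, i2⟩ := h.up hu
    refine ⟨⟨by rw [hT']; omega, fun _ => ?_, fun hn => absurd hu hn⟩, fun ht => f2 ?_⟩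
    · have hle : oscCapital m (p + 1) (oscBet (m + 3) p u v q b) ≤ 5 / 4 :=
        f1.trans (max_le i1 le_rfl)
      refine ⟨hle, ?_⟩
      rcases f3 with f3 | f3
      · exact Or.inl (le_antisymm hle f3)
      · rcases i2 with i2 | i2
        · exact Or.inl ((f2 i2.ge).trans i2)
        · right
          rw [hT', show p + 1 + 1 = p + 2 from rfl]
          refine le_trans ?_ f3
          refine le_trans ?_ (add_le_add_left i2 _)
          have : α * (y' + 1 / 2 ^ (p + 2)) ≤ α * (y + 1 / 2 ^ (p + 1) + D) :=
            mul_le_mul_of_nonneg_left (by linarith) hα0.le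
          linarith
    · rw [atTarget_iff] at ht
      rcases ht with ht | ht
      · exact ht.2
      · exact absurd hu ht.1
  · rw [if_neg hu] at hcap
    obtain ⟨f1, f2, f3⟩ := betDown_spec (w := (b == decide (v ≤ u))) hS0 hx ht3 hs
    rw [← hcap, hsign] at f3
    rw [← hcap] at f1 f2
    obtain ⟨i1, i2⟩ := h.down hu
    refine ⟨⟨by rw [hT']; omega, fun hn => absurd hn hu, fun _ => ?_⟩, fun ht => f2 ?_⟩
    · have hle : 3 / 4 ≤ oscCapital m (p + 1) (oscBet (m + 3) p u v q b) :=
        (le_min i1 le_rfl).trans f1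
      refine ⟨hle, ?_⟩
      rcases f3 with f3 | f3
      · exact Or.inl (le_antisymm f3 hle)
      · rcases i2 with i2 | i2
        · exact Or.inl ((f2 i2.le).trans i2)
        · right
          rw [hT', show p + 1 + 1 = p + 2 from rfl]
          refine f3.trans ?_
          have : α * (y' + 1 / 2 ^ (p + 2)) ≤ α * (y + 1 / 2 ^ (p + 1) + D) :=
            mul_le_mul_of_nonneg_left (by linarith) hα0.le
          linarith
    · rw [atTarget_iff] at ht
      rcases ht with ht | ht
      · exact absurd ht.1 hu
      · exact ht.2

theorem IsMartingale.exists_large {d : List Bool → ℝ} (hd : IsMartingale d) {Z : ℕ → Bool}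
    (hZ : Succeeds d Z) (k₀ : ℕ) (C : ℝ) : ∃ k ≥ k₀, C < d (initialSegment Z k) := by
  -- Exceeding the sum of the first `k₀` values forces `k ≥ k₀`.
  obtain ⟨k, hk⟩ := hZ (max C (∑ i ∈ Finset.range k₀, d (initialSegment Z i)))
  rw [max_lt_iff] at hk
  refine ⟨k, ?_, hk.1⟩
  by_contra! hlt
  have := Finset.single_le_sum (f := fun i => d (initialSegment Z i)) (fun i _ => hd.nonneg _)
    (Finset.mem_range.2 hlt)
  linarith [hk.2]

theorem oscCheck_fst (c p : ℕ) (q : ℕ × ℕ × ℕ × ℕ) : (oscCheck c p q).1 = q.1 := by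
  unfold oscCheck; split_ifs <;> rfl

theorem oscCapital_check (m c p : ℕ) (q : ℕ × ℕ × ℕ × ℕ) :
    oscCapital m p (oscCheck c p q) = oscCapital m p q := by
  rw [oscCapital, oscCheck_fst, oscCapital]

theorem oscState_append (n c : ℕ) (a : List Bool → ℕ → ℕ) (σ : List Bool) (b : Bool) :
    oscState n c a (σ ++ [b]) = oscBet c σ.length (a (σ ++ [true]) (σ.length + 3))
      (a σ (σ.length + 3)) (oscCheck c σ.length (oscState n c a σ)) b :=
  stringRec_append _ _ _ _

theorem oscState_append_snd (n c : ℕ) (a : List Bool → ℕ → ℕ) (σ : List Bool) (b : Bool) :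
    (oscState n c a (σ ++ [b])).2 = (oscCheck c σ.length (oscState n c a σ)).2 := by
  rw [oscState_append]; rfl

/-- Checkpoints are independent of the bits and of the phases. Being multiples of `n`, they are
lengths at which cells are dyadic cubes. -/
theorem oscState_checkpoint {n : ℕ} (hn : 0 < n) (c : ℕ) (a : List Bool → ℕ → ℕ) (σ : List Bool) :
    ∃ j, (oscState n c a σ).2.2.2 = n * 16 ^ j ∧ σ.length ≤ n * 16 ^ j ∧
      ∀ i < j, n * 16 ^ i < σ.length := by
  induction σ using List.reverseRecOn with
  | nil => exact ⟨0, by simp [oscState]⟩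
  | append_singleton σ b ih =>
    obtain ⟨j, h1, h2, h3⟩ := ih
    rw [oscState_append_snd, List.length_append, List.length_singleton]
    by_cases hp : σ.length = n * 16 ^ j
    · refine ⟨j + 1, ?_, ?_, fun i hi => ?_⟩
      · unfold oscCheck
        rw [if_pos (hp.trans h1.symm)]
        split_ifs <;> simp only [h1] <;> ring
      · have : 0 < n * 16 ^ j := by positivity
        rw [hp, pow_succ, ← mul_assoc]; omega
      · have : n * 16 ^ i ≤ n * 16 ^ j :=
          Nat.mul_le_mul_left _ (Nat.pow_le_pow_right (by norm_num) (by omega))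
        omega
    · refine ⟨j, ?_, by omega, fun i hi => (h3 i hi).trans (Nat.lt_succ_self _)⟩
      unfold oscCheck
      rw [if_neg (by rw [h1]; exact hp), h1]

theorem oscState_checkpoint_eq {n : ℕ} (hn : 0 < n) (c : ℕ) (a : List Bool → ℕ → ℕ)
    {σ : List Bool} {j : ℕ} (h : σ.length = n * 16 ^ j) :
    (oscState n c a σ).2.2.2 = σ.length := by
  obtain ⟨i, h1, h2, h3⟩ := oscState_checkpoint hn c a σ
  rw [h] at h2 h3
  have hij : j ≤ i := (Nat.pow_le_pow_iff_right (by norm_num : 1 < 16)).1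
    (Nat.le_of_mul_le_mul_left h2 hn)
  rcases hij.eq_or_lt with rfl | hlt
  · rw [h1, h]
  · exact absurd (h3 j hlt) (lt_irrefl _)

section Oscillating

variable {n m : ℕ} {a : List Bool → ℕ → ℕ} {d : List Bool → ℝ}

theorem oscState_inv (hd : IsMartingale d) (ha : ∀ σ k, |d σ - (a σ k : ℝ) / 2 ^ k| ≤ 1 / 2 ^ k)
    (hm : 4 ≤ m) (hdm : d [] ≤ 2 ^ m / 16) (σ : List Bool) :
    OscInv m (d σ) σ.length (oscState n (m + 3) a σ) ∧
      ∀ b, OscInv m (d (σ ++ [b])) (σ.length + 1) (oscState n (m + 3) a (σ ++ [b])) ∧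
        (AtTarget (m + 3) σ.length (oscCheck (m + 3) σ.length (oscState n (m + 3) a σ)) →
          oscCapital m (σ.length + 1) (oscState n (m + 3) a (σ ++ [b])) =
            oscCapital m σ.length (oscState n (m + 3) a σ)) := by
  have hsmall : ∀ σ : List Bool, d σ ≤ 2 ^ σ.length * (2 ^ m / 16) := fun σ =>
    (hd.le_pow σ).trans (by gcongr)
  have step : ∀ σ, OscInv m (d σ) σ.length (oscState n (m + 3) a σ) → ∀ b,
      OscInv m (d (σ ++ [b])) (σ.length + 1) (oscState n (m + 3) a (σ ++ [b])) ∧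
        (AtTarget (m + 3) σ.length (oscCheck (m + 3) σ.length (oscState n (m + 3) a σ)) →
          oscCapital m (σ.length + 1) (oscState n (m + 3) a (σ ++ [b])) =
            oscCapital m σ.length (oscState n (m + 3) a σ)) := by
    intro σ h b
    have h' := h.check (hsmall σ) hm
    rw [oscState_append, ← oscCapital_check m (m + 3) σ.length (oscState n (m + 3) a σ)]
    refine h'.bet ?_
    have e : (if b then d (σ ++ [b]) - d σ else d σ - d (σ ++ [b])) = d (σ ++ [true]) - d σ := by
      have := hd.fair σ
      cases b
      · simp only [Bool.false_eq_true, if_false]; linarith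
      · simp
    have h1 := ha (σ ++ [true]) (σ.length + 3)
    have h2 := ha σ (σ.length + 3)
    have e2 : (1 : ℝ) / 2 ^ (σ.length + 2) = 1 / 2 ^ (σ.length + 3) + 1 / 2 ^ (σ.length + 3) := by
      rw [pow_succ 2 (σ.length + 2)]; field_simp; norm_num
    rw [e, e2, sub_div]
    rw [abs_le] at h1 h2 ⊢
    constructor <;> linarith [h1.1, h1.2, h2.1, h2.2]
  have main : ∀ σ, OscInv m (d σ) σ.length (oscState n (m + 3) a σ) := by
    intro σ
    induction σ using List.reverseRecOn with
    | nil =>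
      have hs := phase_small (p := 0) (m := m) (y := d []) (by simpa using hdm) hm
      have hcap : oscCapital m 0 (oscState n (m + 3) a []) = 1 := by
        simp [oscCapital, oscState]
      refine ⟨le_rfl, fun _ => ?_, fun h => absurd (by simp [oscState]) h⟩
      rw [List.length_nil, hcap]
      refine ⟨by norm_num, Or.inr ?_⟩
      have hT : (oscState n (m + 3) a []).2.2.1 = 0 := rfl
      rw [hT]
      linarith
    | append_singleton σ b ih =>
      rw [List.length_append, List.length_singleton]
      exact (step σ ih b).1
  exact ⟨main σ, step σ (main σ)⟩

theorem oscState_no_advance {σ : List Bool}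
    (h : ¬ (σ.length = (oscState n (m + 3) a σ).2.2.2 ∧
      AtTarget (m + 3) σ.length (oscState n (m + 3) a σ))) (b : Bool) :
    (oscState n (m + 3) a (σ ++ [b])).2.1 = (oscState n (m + 3) a σ).2.1 ∧
      (oscState n (m + 3) a (σ ++ [b])).2.2.1 = (oscState n (m + 3) a σ).2.2.1 ∧
      (AtTarget (m + 3) σ.length (oscState n (m + 3) a σ) →
        AtTarget (m + 3) σ.length (oscCheck (m + 3) σ.length (oscState n (m + 3) a σ))) := by
  rw [oscState_append_snd]
  unfold oscCheck
  split_ifs with h1 h2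
  · exact absurd ⟨h1, h2⟩ h
  · exact ⟨rfl, rfl, fun h => absurd h h2⟩
  · exact ⟨rfl, rfl, id⟩

theorem oscState_advance {σ : List Bool}
    (h : σ.length = (oscState n (m + 3) a σ).2.2.2 ∧
      AtTarget (m + 3) σ.length (oscState n (m + 3) a σ)) (b : Bool) :
    (oscState n (m + 3) a (σ ++ [b])).2.1 = (oscState n (m + 3) a σ).2.1 + 1 ∧
      (oscState n (m + 3) a (σ ++ [b])).2.2.2 = 16 * σ.length := by
  rw [oscState_append_snd]
  unfold oscCheck
  rw [if_pos h.1, if_pos h.2, ← h.1]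
  exact ⟨rfl, rfl⟩

/-- When an even phase ends at the length `p`, the capital remains at the target up to the length
`16 * p`. -/
theorem oscState_hold (hd : IsMartingale d)
    (ha : ∀ σ k, |d σ - (a σ k : ℝ) / 2 ^ k| ≤ 1 / 2 ^ k) (hm : 4 ≤ m) (hdm : d [] ≤ 2 ^ m / 16)
    {σ : List Bool} (h : σ.length = (oscState n (m + 3) a σ).2.2.2 ∧
      AtTarget (m + 3) σ.length (oscState n (m + 3) a σ))
    (heven : (oscState n (m + 3) a σ).2.1 % 2 = 0) (τ : List Bool)
    (hτ : (σ ++ τ).length ≤ 16 * σ.length) :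
    oscCapital m (σ ++ τ).length (oscState n (m + 3) a (σ ++ τ)) =
      oscCapital m σ.length (oscState n (m + 3) a σ) := by
  -- An odd phase has the target of the even phase before it. It therefore begins at its target and
  -- never bets.
  have hdir : ((oscState n (m + 3) a σ).2.1 + 1) % 4 < 2 ↔
      (oscState n (m + 3) a σ).2.1 % 4 < 2 := by
    omega
  have htgt := h.2
  rw [atTarget_iff] at htgt
  suffices H : ∀ τ : List Bool, (σ ++ τ).length ≤ 16 * σ.length →
      oscCapital m (σ ++ τ).length (oscState n (m + 3) a (σ ++ τ)) =
        oscCapital m σ.length (oscState n (m + 3) a σ) ∧ (τ = [] ∨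
        (oscState n (m + 3) a (σ ++ τ)).2.1 = (oscState n (m + 3) a σ).2.1 + 1 ∧
        (oscState n (m + 3) a (σ ++ τ)).2.2.2 = 16 * σ.length) from (H τ hτ).1
  intro τ
  induction τ using List.reverseRecOn with
  | nil => intro _; simp
  | append_singleton τ b ih =>
    intro hlen
    rw [← List.append_assoc] at hlen ⊢
    rw [List.length_append, List.length_singleton] at hlen
    obtain ⟨ih1, ih2⟩ := ih (by omega)
    have hb := ((oscState_inv (n := n) hd ha hm hdm (σ ++ τ)).2 b).2
    rw [List.length_append (bs := [b]), List.length_singleton]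
    rcases ih2 with rfl | ⟨ih2, ih3⟩
    · rw [List.append_nil] at hb ⊢
      refine ⟨hb ?_, Or.inr (oscState_advance h b)⟩
      rw [atTarget_iff, oscCapital_check]
      have : (oscCheck (m + 3) σ.length (oscState n (m + 3) a σ)).2.1 =
          (oscState n (m + 3) a σ).2.1 + 1 := by
        rw [← oscState_append_snd n (m + 3) a σ b]
        exact (oscState_advance h b).1
      rw [this, hdir]
      exact htgt
    · have hna : ¬ (σ ++ τ).length = (oscState n (m + 3) a (σ ++ τ)).2.2.2 := by
        rw [ih3]; omega
      have hchk : oscCheck (m + 3) (σ ++ τ).length (oscState n (m + 3) a (σ ++ τ)) =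
          oscState n (m + 3) a (σ ++ τ) := by
        unfold oscCheck; rw [if_neg hna]
      refine ⟨(hb ?_).trans ih1, Or.inr ?_⟩
      · rw [hchk, atTarget_iff, ih1, ih2, hdir]
        exact htgt
      · rw [oscState_append_snd, hchk]
        exact ⟨ih2, ih3⟩

/-- Were there no further change of phase, the scale would remain fixed, and the invariant together
with the unboundedness of `d` would force the capital to the target. There it stays, so the next
checkpoint ends the phase after all. -/
theorem exists_checkpoint (hn : 0 < n) (hd : IsMartingale d)
    (ha : ∀ σ k, |d σ - (a σ k : ℝ) / 2 ^ k| ≤ 1 / 2 ^ k) (hm : 4 ≤ m) (hdm : d [] ≤ 2 ^ m / 16)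
    {Z : ℕ → Bool} (hZ : Succeeds d Z) (k₀ : ℕ) :
    ∃ k ≥ k₀, k = (oscState n (m + 3) a (initialSegment Z k)).2.2.2 ∧
      AtTarget (m + 3) k (oscState n (m + 3) a (initialSegment Z k)) := by
  by_contra! hno
  set s := fun k => oscState n (m + 3) a (initialSegment Z k) with hs
  have hstep : ∀ k ≥ k₀, (s (k + 1)).2.1 = (s k).2.1 ∧ (s (k + 1)).2.2.1 = (s k).2.2.1 ∧
      (AtTarget (m + 3) k (s k) → AtTarget (m + 3) (k + 1) (s (k + 1))) := by
    intro k hk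
    have h1 := oscState_no_advance (n := n) (m := m) (a := a) (σ := initialSegment Z k)
      (by rw [length_initialSegment]; exact fun h => hno k hk h.1 h.2) (Z k)
    have h2 := ((oscState_inv (n := n) hd ha hm hdm (initialSegment Z k)).2 (Z k)).2
    rw [← initialSegment_succ, length_initialSegment] at h1 h2
    refine ⟨h1.1, h1.2.1, fun ht => ?_⟩
    have h3 := h2 (h1.2.2 ht)
    rw [atTarget_iff] at ht ⊢
    rw [h3, h1.1]
    exact ht
  have hconst : ∀ k ≥ k₀, (s k).2.2.1 = (s k₀).2.2.1 := by
    intro k hk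
    induction k, hk using Nat.le_induction with
    | base => rfl
    | succ k hk ih => rw [(hstep k hk).2.1, ih]
  obtain ⟨k₁, hk₁, hlarge⟩ := hd.exists_large hZ k₀ (2 ^ ((s k₀).2.2.1 + m))
  have hinv := (oscState_inv (n := n) hd ha hm hdm (initialSegment Z k₁)).1
  rw [length_initialSegment] at hinv
  have hα : 1 < 1 / 2 ^ ((s k₁).2.2.1 + m) * (d (initialSegment Z k₁) + 1 / 2 ^ (k₁ + 1)) := by
    rw [hconst k₁ hk₁, div_mul_eq_mul_div, one_mul, lt_div_iff₀ (by positivity), one_mul]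
    linarith [show (0 : ℝ) < 1 / 2 ^ (k₁ + 1) by positivity]
  have ht : AtTarget (m + 3) k₁ (s k₁) := by
    rw [atTarget_iff]
    by_cases hu : (s k₁).2.1 % 4 < 2
    · obtain ⟨i1, i2⟩ := hinv.up hu
      rcases i2 with i2 | i2
      · exact Or.inl ⟨hu, i2.ge⟩
      · linarith
    · obtain ⟨i1, i2⟩ := hinv.down hu
      rcases i2 with i2 | i2
      · exact Or.inr ⟨hu, i2.le⟩
      · linarith
  have hpers : ∀ k ≥ k₁, AtTarget (m + 3) k (s k) := by
    intro k hk
    induction k, hk using Nat.le_induction with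
    | base => exact ht
    | succ k hk ih => exact (hstep k (hk₁.trans hk)).2.2 ih
  have hbig : k₁ ≤ n * 16 ^ k₁ :=
    (Nat.lt_pow_self (by norm_num)).le.trans (Nat.le_mul_of_pos_left _ hn)
  refine hno (n * 16 ^ k₁) (hk₁.trans hbig) ?_ (hpers _ hbig)
  have := oscState_checkpoint_eq hn (m + 3) a (σ := initialSegment Z (n * 16 ^ k₁)) (j := k₁)
    (by simp)
  rw [this, length_initialSegment]

/-- The least checkpoint at the target after phase `K` has begun ends this very phase. The bound `k
≥ K` makes the ends of phases arbitrarily late. -/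
theorem exists_phase_end (hn : 0 < n) (hd : IsMartingale d)
    (ha : ∀ σ k, |d σ - (a σ k : ℝ) / 2 ^ k| ≤ 1 / 2 ^ k) (hm : 4 ≤ m) (hdm : d [] ≤ 2 ^ m / 16)
    {Z : ℕ → Bool} (hZ : Succeeds d Z) (K : ℕ) :
    ∃ k ≥ K, (oscState n (m + 3) a (initialSegment Z k)).2.1 = K ∧
      k = (oscState n (m + 3) a (initialSegment Z k)).2.2.2 ∧
      AtTarget (m + 3) k (oscState n (m + 3) a (initialSegment Z k)) := by
  classical
  have from_start : ∀ K, ∀ k₀ ≥ K, (oscState n (m + 3) a (initialSegment Z k₀)).2.1 = K →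
      ∃ k ≥ K, (oscState n (m + 3) a (initialSegment Z k)).2.1 = K ∧
      k = (oscState n (m + 3) a (initialSegment Z k)).2.2.2 ∧
      AtTarget (m + 3) k (oscState n (m + 3) a (initialSegment Z k)) := by
    intro K k₀ hk₀ hK
    have hex := exists_checkpoint (n := n) (m := m) (a := a) hn hd ha hm hdm hZ k₀
    obtain ⟨h1, h2, h3⟩ := Nat.find_spec hex
    have hmin := fun j (hj : j < Nat.find hex) => Nat.find_min hex hj
    refine ⟨Nat.find hex, hk₀.trans h1, ?_, h2, h3⟩
    have hconst : ∀ k ≥ k₀, k ≤ Nat.find hex →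
        (oscState n (m + 3) a (initialSegment Z k)).2.1 = K := by
      intro k hk
      induction k, hk using Nat.le_induction with
      | base => exact fun _ => hK
      | succ k hk ih =>
        intro hkf
        have h4 := oscState_no_advance (n := n) (m := m) (a := a) (σ := initialSegment Z k)
          (by rw [length_initialSegment]; exact fun h => hmin k hkf ⟨hk, h⟩) (Z k)
        rw [initialSegment_succ, h4.1, ih (by omega)]
    exact hconst _ h1 le_rfl
  induction K with
  | zero => exact from_start 0 0 le_rfl rfl
  | succ K ih =>
    obtain ⟨k, hk, h1, h2⟩ := ih
    refine from_start (K + 1) (k + 1) (by omega) ?_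
    have := (oscState_advance (n := n) (m := m) (a := a) (σ := initialSegment Z k)
      (by rw [length_initialSegment]; exact h2) (Z k)).1
    rw [initialSegment_succ, this, h1]

end Oscillating

/-- If a computable martingale succeeds on `Z`, then there is a bounded computable martingale that is
at most `3 / 4`, and at least `5 / 4`, on infinitely many long blocks of extensions of initial
segments of `Z`. -/
theorem exists_oscillating_martingale {n : ℕ} (hn : 0 < n) {d : List Bool → ℝ}
    (hd : IsMartingale d) (hc : IsComputableFun d) {Z : ℕ → Bool} (hZ : Succeeds d Z) :
    ∃ M : List Bool → ℝ, IsMartingale M ∧ IsComputableFun M ∧ M [] = 1 ∧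
      (∀ σ, 5 / 8 ≤ M σ) ∧ (∀ σ, M σ ≤ 11 / 8) ∧
      (∀ J, ∃ j ≥ J, ∀ ρ : List Bool, initialSegment Z (n * 16 ^ j) <+: ρ →
        ρ.length ≤ n * 16 ^ (j + 1) → M ρ ≤ 3 / 4) ∧
      (∀ J, ∃ j ≥ J, ∀ ρ : List Bool, initialSegment Z (n * 16 ^ j) <+: ρ →
        ρ.length ≤ n * 16 ^ (j + 1) → 5 / 4 ≤ M ρ) := by
  obtain ⟨a, hac, ha⟩ := hc
  obtain ⟨m, hm, hdm⟩ : ∃ m, 4 ≤ m ∧ d [] ≤ 2 ^ m / 16 := by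
    obtain ⟨k, hk⟩ := pow_unbounded_of_one_lt (d []) (by norm_num : (1 : ℝ) < 2)
    refine ⟨k + 4, by omega, ?_⟩
    rw [pow_add]
    linarith
  set st := oscState n (m + 3) a with hst
  have hinv := oscState_inv (n := n) hd ha hm hdm
  have hfar : ∀ r < 4, r % 2 = 0 → ∀ J, ∃ j ≥ J, (st (initialSegment Z (n * 16 ^ j))).2.1 % 4 = r ∧
      AtTarget (m + 3) (n * 16 ^ j) (st (initialSegment Z (n * 16 ^ j))) ∧
      ∀ ρ : List Bool, initialSegment Z (n * 16 ^ j) <+: ρ → ρ.length ≤ n * 16 ^ (j + 1) →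
        oscCapital m ρ.length (st ρ) =
          oscCapital m (n * 16 ^ j) (st (initialSegment Z (n * 16 ^ j))) := by
    intro r hr hr2 J
    -- This phase number has residue `r` modulo `4` and is large enough to force `j ≥ J`.
    obtain ⟨k, hk, h1, h2, h3⟩ := exists_phase_end (n := n) hn hd ha hm hdm hZ
      (4 * (n * 16 ^ J) + r)
    obtain ⟨j, hj, -, -⟩ := oscState_checkpoint hn (m + 3) a (initialSegment Z k)
    have hkj : k = n * 16 ^ j := h2.trans hj
    subst hkj
    refine ⟨j, ?_, by rw [hst, h1]; omega, h3, fun ρ ⟨τ, hτ⟩ hlen => ?_⟩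
    · by_contra! hlt
      have : n * 16 ^ j ≤ n * 16 ^ J :=
        Nat.mul_le_mul_left _ (Nat.pow_le_pow_right (by norm_num) hlt.le)
      have : 0 < n * 16 ^ J := by positivity
      omega
    · subst hτ
      have := oscState_hold (n := n) hd ha hm hdm (σ := initialSegment Z (n * 16 ^ j))
        (by rw [length_initialSegment]; exact ⟨h2, h3⟩) (by rw [h1]; omega) τ
        (by rw [length_initialSegment]; refine hlen.trans (le_of_eq ?_); ring)
      rw [this, length_initialSegment]
  refine ⟨fun σ => oscCapital m σ.length (st σ), ⟨fun σ => ?_, fun σ => ?_⟩, ?_, ?_, fun σ => ?_,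
    fun σ => ?_, fun J => ?_, fun J => ?_⟩
  · unfold oscCapital; positivity
  · have h := (hinv σ).1.check ((hd.le_pow σ).trans (by gcongr)) hm
    have := oscBet_fair h (hd.nonneg σ) (a (σ ++ [true]) (σ.length + 3)) (a σ (σ.length + 3))
    rw [oscCapital_check, ← oscState_append, ← oscState_append] at this
    simpa using this
  · have hstc := computable_oscState n (m + 3) hac
    refine isComputableFun_div (p := fun σ => (st σ).1)
      (q := fun σ => 4 ^ σ.length * 2 ^ (m + 3)) (Computable.fst.comp hstc) ?_
      (fun σ => by positivity) fun σ => ?_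
    · exact (Primrec.nat_mul.comp (primrec_pow.comp (Primrec.const 4) Primrec.list_length)
        (Primrec.const (2 ^ (m + 3)))).to_comp
    · unfold oscCapital; push_cast; rfl
  · simp [oscCapital, hst, oscState]
  · exact ((hinv σ).1.bounds (hd.nonneg σ)).1
  · exact ((hinv σ).1.bounds (hd.nonneg σ)).2
  · obtain ⟨j, hj, h1, h2, h3⟩ := hfar 2 (by norm_num) rfl J
    refine ⟨j, hj, fun ρ hρ hlen => ?_⟩
    refine (h3 ρ hρ hlen).trans_le ?_
    rw [atTarget_iff] at h2
    rcases h2 with h2 | h2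
    · omega
    · exact h2.2
  · obtain ⟨j, hj, h1, h2, h3⟩ := hfar 0 (by norm_num) rfl J
    refine ⟨j, hj, fun ρ hρ hlen => ?_⟩
    refine le_of_le_of_eq ?_ (h3 ρ hρ hlen).symm
    rw [atTarget_iff] at h2
    rcases h2 with h2 | h2
    · exact h2.2
    · omega

/-! ### The strategy that bets on runs of equal digits -/

/-! The states of the strategy betting on runs are quadruples: the capital (scaled by `4 ^ (p + 1)`
after `p` bits), the beginning `U` of the current block, the bit with index `U`, and whether all
bits since `U` were equal. The strategy bets on a run up to `2 * U` aiming for the capital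
`5 / 4`, and from `3 * U` up to `4 * U` aiming for `3 / 4`. -/

/-- The beginning of the block of the next bit. -/
def runBlock (p : ℕ) (q : ℕ × ℕ × Bool × Bool) : ℕ := if p = 16 * q.2.1 then p else q.2.1

/-- The capital after the next bit `b`. -/
def runBet (p V : ℕ) (q : ℕ × ℕ × Bool × Bool) (b : Bool) : ℕ :=
  -- In real units the stakes are `2 ^ p / 2 ^ (2 * V)` and, in the second window, `2 ^ p / 2 ^ (4 *
  -- V)`. They double while the run lasts and vanish after the first loss; the total won in an
  -- unbroken run would come close to `1`.
  if V < p ∧ p < 2 * V then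
    betUp (4 * q.1) (5 * 4 ^ (p + 1)) (if q.2.2.2 = true then 2 ^ (3 * p + 4 - 2 * V) else 0)
      (b == q.2.2.1)
  else if 3 * V ≤ p ∧ p < 4 * V then
    betDown (4 * q.1) (3 * 4 ^ (p + 1)) (if q.2.2.2 = true then 2 ^ (3 * p + 4 - 4 * V) else 0)
      (b == q.2.2.1)
  else 4 * q.1

/-- The state after the next bit `b`. -/
def runStep (p : ℕ) (q : ℕ × ℕ × Bool × Bool) (b : Bool) : ℕ × ℕ × Bool × Bool :=
  (runBet p (runBlock p q) q b, runBlock p q, if p = runBlock p q then b else q.2.2.1,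
    if p = runBlock p q then true else q.2.2.2 && (b == q.2.2.1))

/-- The strategy betting on runs. -/
def runState : List Bool → ℕ × ℕ × Bool × Bool :=
  stringRec (fun σ q b => runStep σ.length q b) (4, 16, false, false)

theorem computable_lengthRec {S : Type*} [Primcodable S] {B : ℕ → S → Bool → S}
    (hB : Primrec fun r : ℕ × S × Bool => B r.1 r.2.1 r.2.2) (s₀ : S) :
    Computable (stringRec (fun σ q b => B σ.length q b) s₀) :=
  computable_stringRec (Computable.comp hB.to_comp
    (Computable.pair (Computable.list_length.comp Computable.fst) Computable.snd)) s₀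

theorem primrec_runBlock : Primrec₂ runBlock := by
  have hU : Primrec fun r : ℕ × (ℕ × ℕ × Bool × Bool) => r.2.2.1 :=
    Primrec.fst.comp (Primrec.snd.comp Primrec.snd)
  exact Primrec.ite (Primrec.eq.comp Primrec.fst (Primrec.nat_mul.comp (Primrec.const 16) hU))
    Primrec.fst hU

theorem primrec_runBet : Primrec fun r : (ℕ × ℕ) × (ℕ × ℕ × Bool × Bool) × Bool =>
    runBet r.1.1 r.1.2 r.2.1 r.2.2 := by
  have hp : Primrec fun r : (ℕ × ℕ) × (ℕ × ℕ × Bool × Bool) × Bool => r.1.1 :=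
    Primrec.fst.comp Primrec.fst
  have hV : Primrec fun r : (ℕ × ℕ) × (ℕ × ℕ × Bool × Bool) × Bool => r.1.2 :=
    Primrec.snd.comp Primrec.fst
  have hq : Primrec fun r : (ℕ × ℕ) × (ℕ × ℕ × Bool × Bool) × Bool => r.2.1 :=
    Primrec.fst.comp Primrec.snd
  have hb : Primrec fun r : (ℕ × ℕ) × (ℕ × ℕ × Bool × Bool) × Bool => r.2.2 :=
    Primrec.snd.comp Primrec.snd
  have hN : Primrec fun r : (ℕ × ℕ) × (ℕ × ℕ × Bool × Bool) × Bool => 4 * r.2.1.1 :=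
    Primrec.nat_mul.comp (Primrec.const 4) (Primrec.fst.comp hq)
  have hq2 := Primrec.snd.comp (Primrec.snd.comp hq)
  have hw := Primrec.beq.comp hb (Primrec.fst.comp hq2)
  have hal := Primrec.eq.comp (Primrec.snd.comp hq2) (Primrec.const true)
  have hcV : ∀ k : ℕ, Primrec fun r : (ℕ × ℕ) × (ℕ × ℕ × Bool × Bool) × Bool => k * r.1.2 :=
    fun k => Primrec.nat_mul.comp (Primrec.const k) hV
  have hs : ∀ k : ℕ, Primrec fun r : (ℕ × ℕ) × (ℕ × ℕ × Bool × Bool) × Bool =>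
      if r.2.1.2.2.2 = true then 2 ^ (3 * r.1.1 + 4 - k * r.1.2) else 0 := fun k =>
    Primrec.ite hal (primrec_pow.comp (Primrec.const 2) (Primrec.nat_sub.comp
      (Primrec.nat_add.comp (Primrec.nat_mul.comp (Primrec.const 3) hp) (Primrec.const 4))
      (hcV k))) (Primrec.const 0)
  have ht : ∀ k : ℕ, Primrec fun r : (ℕ × ℕ) × (ℕ × ℕ × Bool × Bool) × Bool =>
      k * 4 ^ (r.1.1 + 1) := fun k =>
    Primrec.nat_mul.comp (Primrec.const k) (primrec_pow.comp (Primrec.const 4)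
      (Primrec.succ.comp hp))
  exact Primrec.ite ((Primrec.nat_lt.comp hV hp).and (Primrec.nat_lt.comp hp (hcV 2)))
    (primrec_bet hN (ht 5) (hs 2) hw).1
    (Primrec.ite ((Primrec.nat_le.comp (hcV 3) hp).and (Primrec.nat_lt.comp hp (hcV 4)))
      (primrec_bet hN (ht 3) (hs 4) hw).2 hN)

theorem primrec_bet_comp {S : Type*} [Primcodable S] {B : ℕ → ℕ → S → Bool → ℕ}
    (hB : Primrec fun r : (ℕ × ℕ) × S × Bool => B r.1.1 r.1.2 r.2.1 r.2.2) {V : ℕ → S → ℕ}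
    (hV : Primrec₂ V) : Primrec fun r : ℕ × S × Bool => B r.1 (V r.1 r.2.1) r.2.1 r.2.2 :=
  Primrec.comp hB (Primrec.pair (Primrec.pair Primrec.fst
    (hV.comp Primrec.fst (Primrec.fst.comp Primrec.snd))) Primrec.snd)

theorem computable_runState : Computable runState := by
  refine computable_lengthRec (B := runStep) ?_ _
  have hp : Primrec fun r : ℕ × (ℕ × ℕ × Bool × Bool) × Bool => r.1 := Primrec.fst
  have hq : Primrec fun r : ℕ × (ℕ × ℕ × Bool × Bool) × Bool => r.2.1 :=
    Primrec.fst.comp Primrec.snd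
  have hb : Primrec fun r : ℕ × (ℕ × ℕ × Bool × Bool) × Bool => r.2.2 :=
    Primrec.snd.comp Primrec.snd
  have hV : Primrec fun r : ℕ × (ℕ × ℕ × Bool × Bool) × Bool => runBlock r.1 r.2.1 :=
    primrec_runBlock.comp hp hq
  have hq2 : Primrec fun r : ℕ × (ℕ × ℕ × Bool × Bool) × Bool => r.2.1.2.2 :=
    Primrec.snd.comp (Primrec.snd.comp hq)
  have hN := primrec_bet_comp primrec_runBet primrec_runBlock
  have heq : PrimrecPred fun r : ℕ × (ℕ × ℕ × Bool × Bool) × Bool => r.1 = runBlock r.1 r.2.1 :=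
    Primrec.eq.comp hp hV
  exact Primrec.pair hN (Primrec.pair hV (Primrec.pair
    (Primrec.ite heq hb (Primrec.fst.comp hq2))
    (Primrec.ite heq (Primrec.const true) (Primrec.and.comp (Primrec.snd.comp hq2)
      (Primrec.beq.comp hb (Primrec.fst.comp hq2))))))

/-- The capital of the strategy betting on runs. -/
noncomputable def runCapital (p : ℕ) (q : ℕ × ℕ × Bool × Bool) : ℝ := q.1 / 4 ^ (p + 1)

theorem runState_append (σ : List Bool) (b : Bool) :
    runState (σ ++ [b]) = runStep σ.length (runState σ) b := stringRec_append _ _ _ _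

/-- The invariant of the strategy betting on runs. -/
structure RunInv (p : ℕ) (q : ℕ × ℕ × Bool × Bool) : Prop where
  block : 16 ≤ q.2.1
  le : p ≤ 16 * q.2.1
  -- The margin `4 / 2 ^ U` available at the beginning of a block pays for its losses. What is left,
  -- `4 / 2 ^ (16 * U)`, is the initial margin of the next block.
  lower : 5 / 8 + 4 / 2 ^ (16 * q.2.1) ≤ runCapital p q
  upper : runCapital p q ≤ 11 / 8 - 4 / 2 ^ (16 * q.2.1)
  lower' : p ≤ q.2.1 → 5 / 8 + 4 / 2 ^ q.2.1 ≤ runCapital p q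
  upper' : p ≤ 3 * q.2.1 → runCapital p q ≤ 11 / 8 - 4 / 2 ^ q.2.1
  -- While the run lasts and the target is not reached, the surplus over the margin is at least the
  -- next stake: a loss leaves the margin intact, a win doubles the surplus required.
  up : q.2.1 < p → p ≤ 2 * q.2.1 → q.2.2.2 = true → 5 / 4 ≤ runCapital p q ∨
    5 / 8 + 4 / 2 ^ (16 * q.2.1) + 2 ^ p / 2 ^ (2 * q.2.1) ≤ runCapital p q
  down : 3 * q.2.1 < p → p ≤ 4 * q.2.1 → q.2.2.2 = true → runCapital p q ≤ 3 / 4 ∨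
    runCapital p q ≤ 11 / 8 - 4 / 2 ^ (16 * q.2.1) - 2 ^ p / 2 ^ (4 * q.2.1)

/-- The initial margin covers the first stake of either window together with the margin reserved for
the next block. -/
theorem pow_block_small {V : ℕ} (hV : 16 ≤ V) :
    (4 : ℝ) / 2 ^ (16 * V) + 2 ^ (V + 1) / 2 ^ (2 * V) ≤ 4 / 2 ^ V ∧
      (4 : ℝ) / 2 ^ (16 * V) + 2 ^ (3 * V + 1) / 2 ^ (4 * V) ≤ 4 / 2 ^ V ∧
      (4 : ℝ) / 2 ^ (16 * V) ≤ 4 / 2 ^ V := by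
  have h1 : (4 : ℝ) / 2 ^ (16 * V) ≤ 2 / 2 ^ V := by
    rw [div_le_div_iff₀ (by positivity) (by positivity)]
    have : (2 : ℝ) ^ (V + 1) ≤ 2 ^ (16 * V) := pow_le_pow_right₀ (by norm_num) (by omega)
    rw [pow_succ] at this
    linarith
  have h2 : (2 : ℝ) ^ (V + 1) / 2 ^ (2 * V) = 2 / 2 ^ V := by
    rw [two_mul, pow_add, pow_add]; field_simp
  have h3 : (2 : ℝ) ^ (3 * V + 1) / 2 ^ (4 * V) = 2 / 2 ^ V := by
    rw [show 4 * V = 3 * V + V by ring, pow_add, pow_add]; field_simp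
  have h4 : (2 : ℝ) / 2 ^ V + 2 / 2 ^ V = 4 / 2 ^ V := by rw [← add_div]; norm_num
  have h5 : (0 : ℝ) < 2 / 2 ^ V := by positivity
  rw [h2, h3]
  exact ⟨by linarith, by linarith, by linarith⟩

theorem RunInv.block_change {p : ℕ} {q : ℕ × ℕ × Bool × Bool} (h : RunInv p q) :
    RunInv p (q.1, runBlock p q, q.2.2) ∧ p < 16 * runBlock p q := by
  unfold runBlock
  have h0 := h.block
  split_ifs with hp
  · have hs := pow_block_small (V := 16 * q.2.1) (by omega)
    have hl := h.lower
    have hu := h.upper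
    have e : runCapital p (q.1, p, q.2.2) = runCapital p q := rfl
    refine ⟨⟨by simp only; omega, by simp only; omega, ?_, ?_, fun _ => ?_, fun _ => ?_,
      fun h1 => absurd h1 (lt_irrefl _), fun h1 => ?_⟩, by omega⟩
    · rw [e]; simp only; rw [← hp] at hs; rw [← hp] at hl; linarith [hs.2.2]
    · rw [e]; simp only; rw [← hp] at hs; rw [← hp] at hu; linarith [hs.2.2]
    · rw [e]; simp only; rw [← hp] at hl; exact hl
    · rw [e]; simp only; rw [← hp] at hu; exact hu
    · simp only at h1; omega
  · exact ⟨⟨h.block, h.le, h.lower, h.upper, h.lower', h.upper', h.up, h.down⟩,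
      lt_of_le_of_ne h.le hp⟩

theorem runCapital_eq (p : ℕ) (q : ℕ × ℕ × Bool × Bool) :
    ((4 * q.1 : ℕ) : ℝ) = runCapital p q * 4 ^ (p + 2) := by
  rw [runCapital, pow_succ 4 (p + 1)]; push_cast; field_simp

theorem RunInv.bet {p : ℕ} {q : ℕ × ℕ × Bool × Bool} (h : RunInv p q) (hp : p < 16 * q.2.1)
    (b : Bool) : RunInv (p + 1) (runBet p q.2.1 q b, q.2.1, if p = q.2.1 then b else q.2.2.1,
      if p = q.2.1 then true else q.2.2.2 && (b == q.2.2.1)) := by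
  obtain ⟨N, U, ref, alive⟩ := q
  simp only at hp ⊢
  have hU : 16 ≤ U := h.block
  obtain ⟨hs1, hs2, hs3⟩ := pow_block_small hU
  have hl := h.lower
  have hu := h.upper
  have hl' := h.lower'
  have hu' := h.upper'
  have hup := h.up
  have hdown := h.down
  simp only at hl hu hl' hu' hup hdown
  have hx := runCapital_eq p (N, U, ref, alive)
  set X := runCapital p (N, U, ref, alive) with hX
  simp only at hx
  set A := if p = U then true else alive && (b == ref) with hA
  set R := if p = U then b else ref
  have hS : (0 : ℝ) < 4 ^ (p + 2) := by positivity
  have hcap : ∀ N' : ℕ, runCapital (p + 1) (N', U, R, A) = N' / 4 ^ (p + 2) := fun _ => rfl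
  have e4 : (4 : ℝ) ^ (p + 2) = 2 ^ (2 * p + 4) := by
    rw [show (4 : ℝ) = 2 ^ 2 by norm_num, ← pow_mul]; congr 1
  have hstake : ∀ k, k * U ≤ 3 * p + 4 →
      ((if alive = true then 2 ^ (3 * p + 4 - k * U) else 0 : ℕ) : ℝ) =
        (if alive = true then 2 ^ p / 2 ^ (k * U) else 0) * 4 ^ (p + 2) := by
    intro k hk
    split_ifs
    · rw [e4]
      push_cast
      rw [div_mul_eq_mul_div, ← pow_add, eq_div_iff (by positivity), ← pow_add]
      congr 1; omega
    · simp
  have hdouble : ∀ k, (2 : ℝ) ^ (p + 1) / 2 ^ (k * U) = 2 ^ p / 2 ^ (k * U) + 2 ^ p / 2 ^ (k * U) :=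
    fun k => by rw [pow_succ]; ring
  have hpos : ∀ k, (0 : ℝ) < 2 ^ p / 2 ^ (k * U) := fun k => by positivity
  unfold runBet
  simp only
  by_cases z1 : U < p ∧ p < 2 * U
  · rw [if_pos z1]
    obtain ⟨f1, f2, f3⟩ := betUp_spec (w := (b == ref)) (t := 5 * 4 ^ (p + 1)) (T := 5 / 4) hS hx
      (by push_cast; rw [pow_succ 4 (p + 1)]; ring) (hstake 2 (by omega))
    rw [← hcap] at f1 f2 f3
    set Y := runCapital (p + 1) (betUp (4 * N) (5 * 4 ^ (p + 1))
      (if alive = true then 2 ^ (3 * p + 4 - 2 * U) else 0) (b == ref), U, R, A)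
    have hAe : A = (alive && (b == ref)) := by rw [hA, if_neg (by omega)]
    have hYu : Y ≤ 11 / 8 - 4 / 2 ^ U := by
      refine f1.trans (max_le (hu' (by omega)) ?_)
      have : (4 : ℝ) / 2 ^ U ≤ 1 / 8 := by
        rw [div_le_div_iff₀ (by positivity) (by norm_num)]
        have : (2 : ℝ) ^ 16 ≤ 2 ^ U := pow_le_pow_right₀ (by norm_num) hU
        linarith
      linarith
    have hYl : 5 / 8 + 4 / 2 ^ (16 * U) ≤ Y := by
      rcases f3 with f3 | f3
      · have : (4 : ℝ) / 2 ^ U ≤ 1 / 8 := by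
          rw [div_le_div_iff₀ (by positivity) (by norm_num)]
          have : (2 : ℝ) ^ 16 ≤ 2 ^ U := pow_le_pow_right₀ (by norm_num) hU
          linarith
        linarith
      · cases halive : alive
        · rw [halive] at f3
          simp only [Bool.false_eq_true, if_false, neg_zero, ite_self, add_zero] at f3
          linarith
        · rw [halive] at f3
          simp only [if_true] at f3
          rcases hup z1.1 z1.2.le halive with g | g
          · rw [f2 g]; exact hl
          -- A loss costs at most the surplus recorded in `up`.
          · have := hpos 2
            split_ifs at f3 <;> linarith
    refine ⟨hU, by simp only; omega, hYl, ?_, fun h1 => ?_, fun _ => hYu, fun _ _ hal => ?_,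
      fun h1 => ?_⟩
    · simp only; linarith
    · simp only at h1; omega
    · simp only at hal ⊢
      rw [hAe, Bool.and_eq_true] at hal
      rw [hal.1, hal.2] at f3
      simp only [if_true] at f3
      rcases f3 with f3 | f3
      · exact Or.inl f3
      · rcases hup z1.1 z1.2.le hal.1 with g | g
        · left; exact g.trans (f2 g).ge
        · right; rw [hdouble]; linarith
    · simp only at h1; omega
  rw [if_neg z1]
  by_cases z2 : 3 * U ≤ p ∧ p < 4 * U
  · rw [if_pos z2]
    obtain ⟨f1, f2, f3⟩ := betDown_spec (w := (b == ref)) (t := 3 * 4 ^ (p + 1)) (T := 3 / 4) hS hx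
      (by push_cast; rw [pow_succ 4 (p + 1)]; ring) (hstake 4 (by omega))
    rw [← hcap] at f1 f2 f3
    set Y := runCapital (p + 1) (betDown (4 * N) (3 * 4 ^ (p + 1))
      (if alive = true then 2 ^ (3 * p + 4 - 4 * U) else 0) (b == ref), U, R, A)
    have hAe : A = (alive && (b == ref)) := by rw [hA, if_neg (by omega)]
    have hsm : (4 : ℝ) / 2 ^ (16 * U) ≤ 1 / 8 := by
      rw [div_le_div_iff₀ (by positivity) (by norm_num)]
      have : (2 : ℝ) ^ 16 ≤ 2 ^ (16 * U) := pow_le_pow_right₀ (by norm_num) (by omega)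
      linarith
    have hYl : 5 / 8 + 4 / 2 ^ (16 * U) ≤ Y := le_trans (le_min hl (by linarith)) f1
    have hd : alive = true → X ≤ 3 / 4 ∨
        X ≤ 11 / 8 - 4 / 2 ^ (16 * U) - 2 ^ p / 2 ^ (4 * U) := by
      intro hal
      -- At the first bit of the second window the invariant `down` says nothing yet; `upper'`
      -- supplies the bound.
      rcases z2.1.eq_or_lt with z | z
      · right
        have h1 := hu' z.symm.le
        have h2 := hdouble 4
        rw [← z] at h2 ⊢
        have h3 := hpos 4
        rw [← z] at h3
        linarith
      · exact hdown z z2.2.le hal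
    have hYu : Y ≤ 11 / 8 - 4 / 2 ^ (16 * U) := by
      rcases f3 with f3 | f3
      · linarith
      · cases halive : alive
        · rw [halive] at f3
          simp only [Bool.false_eq_true, if_false, neg_zero, ite_self, sub_zero] at f3
          linarith
        · rw [halive] at f3
          simp only [if_true] at f3
          rcases hd halive with g | g
          · rw [f2 g]; exact hu
          · have := hpos 4
            split_ifs at f3 <;> linarith
    refine ⟨hU, by simp only; omega, hYl, hYu, fun h1 => ?_, fun h1 => ?_, fun _ h1 => ?_,
      fun _ _ hal => ?_⟩
    · simp only at h1; omega
    · simp only at h1; omega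
    · simp only at h1; omega
    · simp only at hal ⊢
      rw [hAe, Bool.and_eq_true] at hal
      rw [hal.1, hal.2] at f3
      simp only [if_true] at f3
      rcases f3 with f3 | f3
      · exact Or.inl f3
      · rcases hd hal.1 with g | g
        · left; exact (f2 g).le.trans g
        · right; rw [hdouble]; linarith
  · rw [if_neg z2]
    have hY : runCapital (p + 1) (4 * N, U, R, A) = X := by
      rw [hcap, hx, mul_div_cancel_right₀ _ hS.ne']
    refine ⟨hU, by simp only; omega, by rw [hY]; exact hl, by rw [hY]; exact hu,
      fun h1 => by rw [hY]; exact hl' (by simp only at h1; omega),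
      fun h1 => by rw [hY]; exact hu' (by simp only at h1; omega), fun h1 h2 hal => ?_,
      fun h1 h2 hal => ?_⟩
    · rw [hY]
      simp only at h1 h2 ⊢
      have hpU : p = U := by omega
      right
      have := hl' hpU.le
      rw [hpU]
      linarith
    · simp only at h1 h2; omega

theorem runState_inv (σ : List Bool) : RunInv σ.length (runState σ) := by
  induction σ using List.reverseRecOn with
  | nil =>
    have e : runState [] = (4, 16, false, false) := rfl
    rw [e, List.length_nil]
    constructor <;> norm_num [runCapital]
  | append_singleton σ b ih =>
    obtain ⟨h1, h2⟩ := ih.block_change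
    rw [runState_append, List.length_append, List.length_singleton]
    exact h1.bet h2 b

theorem runState_fair (σ : List Bool) :
    runCapital (σ.length + 1) (runState (σ ++ [false])) +
      runCapital (σ.length + 1) (runState (σ ++ [true])) =
        2 * runCapital σ.length (runState σ) := by
  have hx : 5 * 4 ^ (σ.length + 1) ≤ 2 * (4 * (runState σ).1) := by
    have h1 : 5 / 8 ≤ runCapital σ.length (runState σ) := by
      have := (runState_inv σ).lower
      have h2 : (0 : ℝ) < 4 / 2 ^ (16 * (runState σ).2.1) := by positivity
      linarith
    rw [runCapital, div_le_div_iff₀ (by norm_num) (by positivity),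
      mul_comm ((runState σ).1 : ℝ)] at h1
    have : 5 * 4 ^ (σ.length + 1) ≤ 8 * (runState σ).1 := by exact_mod_cast h1
    omega
  have e : ∀ A B : ℕ, A + B = 2 * (4 * (runState σ).1) → (A : ℝ) / 4 ^ (σ.length + 1 + 1) +
      B / 4 ^ (σ.length + 1 + 1) = 2 * runCapital σ.length (runState σ) := by
    intro A B hAB
    have : (A : ℝ) + B = 2 * (4 * (runState σ).1) := by exact_mod_cast hAB
    rw [← add_div, this, runCapital, pow_succ 4 (σ.length + 1)]
    field_simp
  rw [runState_append, runState_append]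
  refine e _ _ ?_
  simp only [runStep]
  generalize runBlock σ.length (runState σ) = V
  unfold runBet
  have hd : (true == (runState σ).2.2.1) = !(false == (runState σ).2.2.1) := by
    cases (runState σ).2.2.1 <;> rfl
  rw [hd]
  split_ifs
  · exact betUp_fair hx _ _
  · exact betUp_fair hx _ _
  · exact betDown_fair _ _ _ _
  · exact betDown_fair _ _ _ _
  · ring

theorem runState_initialSegment_succ (X : ℕ → Bool) (p : ℕ) :
    runState (initialSegment X (p + 1)) = runStep p (runState (initialSegment X p)) (X p) := by
  rw [initialSegment_succ, runState_append, length_initialSegment]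

/-- In the block beginning at `V`, the strategy remembers `V`, the bit with index `V`, and whether
all bits since then agree with it. -/
theorem runState_block {X : ℕ → Bool} {V : ℕ}
    (h : runBlock V (runState (initialSegment X V)) = V) {p : ℕ} (h1 : V < p) (h2 : p ≤ 16 * V) :
    (runState (initialSegment X p)).2.1 = V ∧ ((∀ k, V ≤ k → k < p → X k = X V) →
      (runState (initialSegment X p)).2.2 = (X V, true)) := by
  induction p, h1 using Nat.le_induction with
  | base =>
    rw [runState_initialSegment_succ]
    simp only [runStep, h, if_true, true_and, implies_true]
  | succ p hp ih =>
    obtain ⟨ih1, ih2⟩ := ih (by omega)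
    have hb : runBlock p (runState (initialSegment X p)) = V := by
      rw [runBlock, ih1, if_neg (by omega)]
    rw [runState_initialSegment_succ]
    simp only [runStep, hb, true_and]
    intro hk
    rw [ih2 fun k hk1 hk2 => hk k hk1 (by omega), if_neg (by omega), if_neg (by omega),
      hk p (by omega) (by omega)]
    simp

theorem runBlock_pow (X : ℕ → Bool) (j : ℕ) :
    runBlock (16 ^ (j + 1)) (runState (initialSegment X (16 ^ (j + 1)))) = 16 ^ (j + 1) := by
  induction j with
  | zero =>
    have h : ∀ p, p ≤ 16 → (runState (initialSegment X p)).2.1 = 16 := by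
      intro p
      induction p with
      | zero => intro _; rfl
      | succ p ih =>
        intro hp
        rw [runState_initialSegment_succ]
        simp only [runStep, runBlock, ih (by omega)]
        rw [if_neg (by omega)]
    rw [runBlock, h _ (by norm_num)]
    norm_num
  | succ j ih =>
    have hp : 0 < 16 ^ (j + 1) := by positivity
    rw [runBlock, (runState_block ih (p := 16 ^ (j + 1 + 1)) (by rw [pow_succ 16 (j + 1)]; omega)
      (by rw [pow_succ 16 (j + 1)]; omega)).1, if_pos (by rw [pow_succ 16 (j + 1), mul_comm])]

/-- The capital of the strategy betting on runs after `p` bits of `X`. -/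
noncomputable def runCapitalAlong (X : ℕ → Bool) (p : ℕ) : ℝ :=
  runCapital p (runState (initialSegment X p))

/-- The pauses let the capital reached after `2 * V` or `4 * V` digits be read off from much smaller
cells, of level `3 * V` or `5 * V`. -/
theorem runCapitalAlong_idle {X : ℕ → Bool} {V : ℕ} (_hV : 0 < V)
    (h : runBlock V (runState (initialSegment X V)) = V) {p p' : ℕ} (hp : p ≤ p')
    (hi : 2 * V ≤ p ∧ p' ≤ 3 * V ∨ 4 * V ≤ p ∧ p' ≤ 16 * V) :
    runCapitalAlong X p' = runCapitalAlong X p := by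
  induction p', hp using Nat.le_induction with
  | base => rfl
  | succ p' hp ih =>
    have hb : runBlock p' (runState (initialSegment X p')) = V := by
      rw [runBlock, (runState_block h (by omega) (by omega)).1, if_neg (by omega)]
    rw [← ih (by omega), runCapitalAlong, runState_initialSegment_succ]
    simp only [runStep, hb, runBet]
    rw [if_neg (by omega), if_neg (by omega), runCapitalAlong, runCapital, runCapital_eq,
      mul_div_assoc, div_self (by positivity), mul_one]

theorem runInv_along (X : ℕ → Bool) (p : ℕ) : RunInv p (runState (initialSegment X p)) := by
  simpa using runState_inv (initialSegment X p)

/-- At the end of the window the surplus in `up` would be `1`, and `5 / 8 + 1` exceeds the target,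
so the target has been reached. -/
theorem le_runCapitalAlong_of_run {X : ℕ → Bool} {V : ℕ} (hV : 0 < V)
    (h : runBlock V (runState (initialSegment X V)) = V)
    (hX : ∀ k, V ≤ k → k < 2 * V → X k = X V) : 5 / 4 ≤ runCapitalAlong X (3 * V) := by
  rw [runCapitalAlong_idle hV h (p := 2 * V) (by omega) (by omega)]
  obtain ⟨h1, h2⟩ := runState_block h (p := 2 * V) (by omega) (by omega)
  have hi := (runInv_along X (2 * V)).up
  rw [h1, h2 hX, div_self (by positivity)] at hi
  have : (0 : ℝ) < 4 / 2 ^ (16 * V) := by positivity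
  rcases hi (by omega) le_rfl rfl with hi | hi
  · exact hi
  · exact le_trans (by linarith) hi

theorem runCapitalAlong_le_of_run {X : ℕ → Bool} {V : ℕ} (hV : 0 < V)
    (h : runBlock V (runState (initialSegment X V)) = V)
    (hX : ∀ k, V ≤ k → k < 4 * V → X k = X V) : runCapitalAlong X (5 * V) ≤ 3 / 4 := by
  rw [runCapitalAlong_idle hV h (p := 4 * V) (by omega) (by omega)]
  obtain ⟨h1, h2⟩ := runState_block h (p := 4 * V) (by omega) (by omega)
  have hi := (runInv_along X (4 * V)).down
  rw [h1, h2 hX, div_self (by positivity)] at hi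
  have : (0 : ℝ) < 4 / 2 ^ (16 * V) := by positivity
  rcases hi (by omega) le_rfl rfl with hi | hi
  · exact hi
  · exact le_trans hi (by linarith)

/-! ### Betting on the digits of a single coordinate -/

/-- The bits of the `i`-th coordinate, among `n` interleaved ones. -/
def coordBits (n i : ℕ) : List Bool → List Bool :=
  stringRec (fun σ q b => if σ.length % n = i then q ++ [b] else q) []

theorem coordBits_append (n i : ℕ) (σ : List Bool) (b : Bool) : coordBits n i (σ ++ [b]) =
    if σ.length % n = i then coordBits n i σ ++ [b] else coordBits n i σ := stringRec_append _ _ _ _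

theorem computable_coordBits (n i : ℕ) : Computable (coordBits n i) := by
  refine computable_lengthRec (B := fun p q b => if p % n = i then q ++ [b] else q) ?_ _
  have hq : Primrec fun r : ℕ × List Bool × Bool => r.2.1 := Primrec.fst.comp Primrec.snd
  exact Primrec.ite (Primrec.eq.comp (Primrec.nat_mod.comp Primrec.fst (Primrec.const n))
    (Primrec.const i)) (Primrec.list_concat.comp hq (Primrec.snd.comp Primrec.snd)) hq

theorem coordBits_initialSegment {n i : ℕ} (hi : i < n) (Z : ℕ → Bool) (t : ℕ) :
    coordBits n i (initialSegment Z (n * t)) = initialSegment (fun s => Z (n * s + i)) t := by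
  induction t with
  | zero => rfl
  | succ t ih =>
    -- In each round of `n` bits only the one at position `i` is appended.
    have h : ∀ r ≤ n, coordBits n i (initialSegment Z (n * t + r)) =
        initialSegment (fun s => Z (n * s + i)) (if r ≤ i then t else t + 1) := by
      intro r
      induction r with
      | zero => intro _; simpa using ih
      | succ r ihr =>
        intro hr
        rw [← add_assoc, initialSegment_succ, coordBits_append, ihr (by omega),
          length_initialSegment, Nat.mul_add_mod, Nat.mod_eq_of_lt (by omega)]
        rcases lt_trichotomy r i with h | h | h
        · rw [if_neg h.ne, if_pos h.le, if_pos (by omega)]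
        · rw [if_pos h, if_pos h.le, if_neg (by omega), initialSegment_succ, h]
        · rw [if_neg h.ne', if_neg (by omega), if_neg (by omega)]
    have := h n le_rfl
    rwa [if_neg (by omega)] at this

/-- The martingale betting on runs of the `i`-th coordinate. -/
noncomputable def runMartingale (n i : ℕ) (σ : List Bool) : ℝ :=
  runCapital (coordBits n i σ).length (runState (coordBits n i σ))

theorem le_runMartingale (n i : ℕ) (σ : List Bool) : 5 / 8 ≤ runMartingale n i σ :=
  le_trans (by simp only [le_add_iff_nonneg_right]; positivity)
    (runState_inv (coordBits n i σ)).lower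

theorem runMartingale_le (n i : ℕ) (σ : List Bool) : runMartingale n i σ ≤ 11 / 8 :=
  (runState_inv (coordBits n i σ)).upper.trans
    (by simp only [tsub_le_iff_right, le_add_iff_nonneg_right]; positivity)

theorem isMartingale_runMartingale (n i : ℕ) : IsMartingale (runMartingale n i) where
  nonneg σ := le_trans (by norm_num) (le_runMartingale n i σ)
  fair σ := by
    unfold runMartingale
    rw [coordBits_append, coordBits_append]
    split_ifs
    · simpa using runState_fair (coordBits n i σ)
    · ring

theorem isComputableFun_runMartingale (n i : ℕ) : IsComputableFun (runMartingale n i) := by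
  have h := computable_coordBits n i
  have hs : Computable fun σ => runState (coordBits n i σ) := computable_runState.comp h
  refine isComputableFun_div (p := fun σ => (runState (coordBits n i σ)).1)
    (q := fun σ => 4 ^ ((coordBits n i σ).length + 1)) (Computable.fst.comp hs) ?_
    (fun σ => by positivity) fun σ => by rw [runMartingale, runCapital]; push_cast; rfl
  exact primrec_pow.to_comp.comp (Computable.const 4)
    (Computable.succ.comp (Computable.list_length.comp h))

theorem runMartingale_initialSegment {n i : ℕ} (hi : i < n) (Z : ℕ → Bool) (t : ℕ) :
    runMartingale n i (initialSegment Z (n * t)) =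
      runCapitalAlong (fun s => Z (n * s + i)) t := by
  rw [runMartingale, coordBits_initialSegment hi, length_initialSegment, runCapitalAlong]

theorem runMartingale_nil (n i : ℕ) : runMartingale n i [] = 1 := by
  have h : runMartingale n i [] = runCapital 0 (4, 16, false, false) := rfl
  rw [h]
  norm_num [runCapital]

/-! ### The two cases: `z` close to dyadic rationals, or not -/

section

theorem abs_sub_lt_of_mem_ball {n : ℕ} {x z : EuclideanSpace ℝ (Fin n)} {r : ℝ}
    (h : x ∈ Metric.ball z r) (i : Fin n) : |x i - z i| < r := by
  have h1 := PiLp.norm_apply_le (x - z) i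
  rw [Metric.mem_ball, dist_eq_norm] at h
  exact lt_of_le_of_lt (by simpa using h1) h

variable {n : ℕ} [NeZero n]

theorem exists_forall_const_div_le {ε c : ℝ} (hε : 0 < ε) :
    ∃ J : ℕ, ∀ j ≥ J, 1 / 2 ^ (16 ^ j) < ε ∧ c / 2 ^ (16 ^ j) ≤ ε := by
  have h : Tendsto (fun j : ℕ => (2 : ℝ) ^ (16 ^ j)) atTop atTop :=
    (tendsto_pow_atTop_atTop_of_one_lt (by norm_num : (1 : ℝ) < 2)).comp
      (tendsto_pow_atTop_atTop_of_one_lt (by norm_num : 1 < 16))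
  have h1 := (h.const_div_atTop 1).eventually_lt_const hε
  have h2 := (h.const_div_atTop c).eventually_le_const hε
  exact eventually_atTop.1 (h1.and h2)

theorem div_pow_le_mul {ε c : ℝ} (hc : 0 ≤ c) {a b s : ℕ} (hs : c / 2 ^ s ≤ ε) (hab : b + s ≤ a) :
    c / 2 ^ a ≤ ε * (1 / 2 ^ b) := by
  refine le_trans ?_ (mul_le_mul_of_nonneg_right hs (by positivity))
  rw [div_mul_div_comm, mul_one, ← pow_add]
  exact div_le_div_of_nonneg_left hc (by positivity) (pow_le_pow_right₀ (by norm_num) (by omega))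

theorem one_div_pow_lt {ε : ℝ} {b s : ℕ} (hs : 1 / 2 ^ s < ε) (hsb : s ≤ b) : 1 / 2 ^ b < ε :=
  lt_of_le_of_lt (one_div_le_one_div_of_le (by positivity)
    (pow_le_pow_right₀ (by norm_num) hsb)) hs

/-- If no coordinate of `z` has constant digits along a block, then close points have the same
digits before this block. -/
theorem initialSegment_prefix_of_not_const {z : EuclideanSpace ℝ (Fin n)} (hz : z ∈ cell n [])
    {s t T : ℕ} (hst : s < t) (hsT : s ≤ T)
    (hne : ∀ i, ¬ ∀ k, s ≤ k → k < t → bit (z i) k = bit (z i) s) {σ : List Bool}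
    (hσ : σ.length = n * T) (hb : (cell n σ ∩ Metric.ball z (1 / 2 ^ t)).Nonempty) :
    initialSegment (binaryExpansion z) (n * s) <+: σ := by
  obtain ⟨x, hx, hxz⟩ := hb
  obtain ⟨hx0, hxσ⟩ := mem_cell.1 hx
  have h := (initialSegment_eq_iff_floor hx0 hz s).2 fun i =>
    floor_eq_of_not_const (mem_cell_nil.1 hx0 i) (mem_cell_nil.1 hz i) hst (hne i)
      (abs_sub_lt_of_mem_ball hxz i)
  rw [← h, ← hxσ, hσ, initialSegment, initialSegment]
  obtain ⟨m, hm⟩ := Nat.exists_eq_add_of_le (Nat.mul_le_mul_left n hsT)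
  rw [hm, List.range_add, List.map_append]
  exact List.prefix_append _ _

/-- Near a point whose `i`-th coordinate is close to a dyadic rational, the value of the martingale
betting on runs is its capital along a sequence with a constant block. -/
theorem exists_runMartingale_eq {z : EuclideanSpace ℝ (Fin n)} {i : Fin n} {s t : ℕ} {p : ℤ}
    (hst : s < t) (hp : |z i - p / 2 ^ s| ≤ 1 / 2 ^ (t + 1)) {T : ℕ} {σ : List Bool}
    (hσ : σ.length = n * T) (hb : (cell n σ ∩ Metric.ball z (1 / 2 ^ (t + 1))).Nonempty) :
    ∃ X : ℕ → Bool, (∀ k, s ≤ k → k < t → X k = X s) ∧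
      runMartingale n i σ = runCapitalAlong X T := by
  obtain ⟨x, hx, hxz⟩ := hb
  obtain ⟨hx0, hxσ⟩ := mem_cell.1 hx
  have hX : (fun s => binaryExpansion x (n * s + i)) = bit (x i) :=
    funext fun s => binaryExpansion_level_of_mem hx0 s i
  -- `x` may lie on the other side of the dyadic rational than `z` and have the opposite digits;
  -- only their constancy matters.
  refine ⟨bit (x i), fun k => bit_const_of_near (mem_cell_nil.1 hx0 i) hst (p := p) ?_, ?_⟩
  · calc |x i - p / 2 ^ s| ≤ |x i - z i| + |z i - p / 2 ^ s| := abs_sub_le _ _ _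
      _ < 1 / 2 ^ (t + 1) + 1 / 2 ^ (t + 1) :=
        add_lt_add_of_lt_of_le (abs_sub_lt_of_mem_ball hxz i) hp
      _ = 1 / 2 ^ t := by rw [pow_succ]; field_simp; norm_num
  · rw [← hX, ← runMartingale_initialSegment i.2, ← hσ, hxσ]

/-- If the digits of some coordinate of `z` are constant along infinitely many blocks, then the
martingale betting on runs of this coordinate induces a measure that is not differentiable at
`z`. -/
theorem runMartingale_not_hasLebesgueDerivativeAt {z : EuclideanSpace ℝ (Fin n)}
    (hz : ∀ i, z i ∈ Set.Icc (0 : ℝ) 1) {i : Fin n}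
    (h : ∀ J, ∃ j ≥ J, ∀ k, 16 ^ j ≤ k → k < 5 * 16 ^ j →
      bit (Int.fract (z i)) k = bit (Int.fract (z i)) (16 ^ j))
    {μ : Measure (EuclideanSpace ℝ (Fin n))} (hμ : IsInducedMeasure (runMartingale n i) μ) :
    ¬ HasLebesgueDerivativeAt μ z := by
  have hnear : ∀ ε > 0, ∃ V : ℕ, 2 ≤ V ∧ (1 : ℝ) / 2 ^ V < ε ∧ (n : ℝ) * 2 / 2 ^ V ≤ ε ∧
      (∀ X : ℕ → Bool, runBlock V (runState (initialSegment X V)) = V) ∧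
      ∃ p : ℤ, |z i - p / 2 ^ V| ≤ 1 / 2 ^ (5 * V) := by
    intro ε hε
    obtain ⟨J, hJ⟩ := exists_forall_const_div_le (c := n * 2) hε
    obtain ⟨j, hj, hc⟩ := h (J + 1)
    obtain ⟨j, rfl⟩ := Nat.exists_eq_succ_of_ne_zero (by omega : j ≠ 0)
    have h2 : 2 ≤ 16 ^ (j + 1) := by
      have : 0 < 16 ^ j := by positivity
      rw [pow_succ]; omega
    refine ⟨16 ^ (j + 1), h2, (hJ _ (by omega)).1, (hJ _ (by omega)).2,
      fun X => runBlock_pow X j, ?_⟩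
    obtain ⟨p, hp⟩ := near_of_bit_const ⟨Int.fract_nonneg _, Int.fract_lt_one _⟩ (by omega) hc
    -- The integer part is restored for the sake of `z i = 1`: its fractional part is `0`, but the
    -- nearby points of the cube are close to `1`.
    refine ⟨⌊z i⌋ * 2 ^ 16 ^ (j + 1) + p, ?_⟩
    convert hp using 2
    rw [Int.fract]
    push_cast
    field_simp
    ring
  refine hμ.not_hasLebesgueDerivativeAt hz (a := 3 / 4) (b := 5 / 4) (by norm_num) (by norm_num)
    (fun ε hε => ?_) (fun ε hε => ?_)
  · obtain ⟨V, hV, h1, h2, hb, p, hp⟩ := hnear ε hε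
    -- Within this radius the digits are constant up to `4 * V`. Cells of level `5 * V` are
    -- negligibly small compared to it and still carry the capital reached there.
    refine ⟨1 / 2 ^ (4 * V + 1), by positivity, one_div_pow_lt h1 (by omega), 5 * V, ?_,
      fun σ hσ hne => ?_⟩
    · have := div_pow_le_mul (b := 4 * V + 1) (a := 5 * V + 1) (by positivity) h2 (by omega)
      refine le_trans (le_of_eq ?_) this
      rw [pow_succ]; field_simp
    · obtain ⟨X, hX, e⟩ := exists_runMartingale_eq (by omega) (hp.trans (one_div_le_one_div_of_le
        (by positivity) (pow_le_pow_right₀ (by norm_num) (by omega)))) hσ hne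
      rw [e]
      exact runCapitalAlong_le_of_run (by omega) (hb X) hX
  · obtain ⟨V, hV, h1, h2, hb, p, hp⟩ := hnear ε hε
    refine ⟨1 / 2 ^ (2 * V + 1), by positivity, one_div_pow_lt h1 (by omega), 3 * V, ?_,
      fun σ hσ hne => ?_⟩
    · have := div_pow_le_mul (b := 2 * V + 1) (a := 3 * V + 1) (by positivity) h2 (by omega)
      refine le_trans (le_of_eq ?_) this
      rw [pow_succ]; field_simp
    · obtain ⟨X, hX, e⟩ := exists_runMartingale_eq (by omega) (hp.trans (one_div_le_one_div_of_le
        (by positivity) (pow_le_pow_right₀ (by norm_num) (by omega)))) hσ hne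
      rw [e]
      exact le_runCapitalAlong_of_run (by omega) (hb X) hX

/-- If the digits of the coordinates of `z` are not constant along blocks, then a martingale that
oscillates along blocks of the expansion of `z` induces a measure that is not differentiable at
`z`. -/
theorem oscillating_not_hasLebesgueDerivativeAt {z : EuclideanSpace ℝ (Fin n)}
    (hz : z ∈ cell n []) {J₀ : ℕ}
    (h : ∀ j ≥ J₀, ∀ i, ¬ ∀ k, 16 ^ j ≤ k → k < 5 * 16 ^ j → bit (z i) k = bit (z i) (16 ^ j))
    {M : List Bool → ℝ}
    (hA : ∀ J, ∃ j ≥ J, ∀ ρ, initialSegment (binaryExpansion z) (n * 16 ^ j) <+: ρ →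
      ρ.length ≤ n * 16 ^ (j + 1) → M ρ ≤ 3 / 4)
    (hB : ∀ J, ∃ j ≥ J, ∀ ρ, initialSegment (binaryExpansion z) (n * 16 ^ j) <+: ρ →
      ρ.length ≤ n * 16 ^ (j + 1) → 5 / 4 ≤ M ρ)
    {μ : Measure (EuclideanSpace ℝ (Fin n))} (hμ : IsInducedMeasure M μ) :
    ¬ HasLebesgueDerivativeAt μ z := by
  have key : ∀ {P : List Bool → Prop}, (∀ J, ∃ j ≥ J, ∀ ρ,
      initialSegment (binaryExpansion z) (n * 16 ^ j) <+: ρ → ρ.length ≤ n * 16 ^ (j + 1) → P ρ) →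
      ∀ ε > 0, ∃ r : ℝ, 0 < r ∧ r < ε ∧ ∃ t : ℕ, (n : ℝ) / 2 ^ t ≤ ε * r ∧
        ∀ σ, σ.length = n * t → (cell n σ ∩ Metric.ball z r).Nonempty → P σ := by
    intro P hP ε hε
    obtain ⟨J, hJ⟩ := exists_forall_const_div_le (c := n) hε
    obtain ⟨j, hj, hp⟩ := hP (max J J₀)
    obtain ⟨h1, h2⟩ := hJ j ((le_max_left _ _).trans hj)
    have h0 : 0 < 16 ^ j := by positivity
    have hs : 16 ^ (j + 1) = 16 * 16 ^ j := by rw [pow_succ, mul_comm]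
    -- The ball lies within the digits that `z` has before `16 ^ j`, and `M` keeps its bound on
    -- extensions up to level `16 ^ (j + 1)`. As `16 > 5`, cells of that level are negligible
    -- compared to the radius.
    refine ⟨1 / 2 ^ (5 * 16 ^ j), by positivity, one_div_pow_lt h1 (by omega), 16 ^ (j + 1),
      div_pow_le_mul (by positivity) h2 (by omega), fun σ hσ hne => hp σ ?_ hσ.le⟩
    exact initialSegment_prefix_of_not_const hz (by omega) (by omega)
      (h j ((le_max_right _ _).trans hj)) hσ hne
  exact hμ.not_hasLebesgueDerivativeAt (fun i => Set.Ico_subset_Icc_self (mem_cell_nil.1 hz i))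
    (by norm_num) (by norm_num) (key hA) (key hB)

theorem propertyP2_of_bounds {M : List Bool → ℝ} (h1 : ∀ σ, 5 / 8 ≤ M σ)
    (h2 : ∀ σ, M σ ≤ 11 / 8) : PropertyP2 M :=
  ⟨2, fun σ => ⟨lt_of_lt_of_le (by norm_num) (h1 σ), lt_of_le_of_lt (h2 σ) (by norm_num)⟩⟩

end

end CompRand

theorem mainTheorem8 (n : ℕ) [NeZero n] (z : EuclideanSpace ℝ (Fin n))
    (hz : ∀ i, z i ∈ Set.Icc (0 : ℝ) 1) (hzr : ¬ CompRand.IsComputablyRandom z) :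
    ∃ M : List Bool → ℝ, CompRand.IsMartingale M ∧ CompRand.IsComputableFun M ∧
      CompRand.PropertyP2 M ∧
      ∃ μ : MeasureTheory.Measure (EuclideanSpace ℝ (Fin n)),
        CompRand.IsInducedMeasure M μ ∧ CompRand.PropertyP1 μ z ∧ CompRand.DensityBounded μ := by
  open CompRand in
  suffices ∃ M : List Bool → ℝ, IsMartingale M ∧ IsComputableFun M ∧ M [] = 1 ∧
      (∀ σ, 5 / 8 ≤ M σ) ∧ (∀ σ, M σ ≤ 11 / 8) ∧ ∀ μ : Measure (EuclideanSpace ℝ (Fin n)),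
        IsInducedMeasure M μ → ¬ HasLebesgueDerivativeAt μ z by
    obtain ⟨M, hM, hc, h1, hl, hu, hd⟩ := this
    obtain ⟨μ, hμ, hac, hb⟩ := exists_isInducedMeasure (n := n) hM h1 (by norm_num) hl hu
    exact ⟨M, hM, hc, propertyP2_of_bounds hl hu, μ, hμ, ⟨hac, hd μ hμ⟩, hb⟩
  -- The failure of randomness is used only in the second case; in the first, the runs themselves
  -- are what a strategy exploits.
  by_cases h : ∃ i, ∀ J, ∃ j ≥ J, ∀ k, 16 ^ j ≤ k → k < 5 * 16 ^ j →
      CompRand.bit (Int.fract (z i)) k = CompRand.bit (Int.fract (z i)) (16 ^ j)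
  · obtain ⟨i, hi⟩ := h
    exact ⟨CompRand.runMartingale n i, CompRand.isMartingale_runMartingale n i,
      CompRand.isComputableFun_runMartingale n i, CompRand.runMartingale_nil n i,
      CompRand.le_runMartingale n i, CompRand.runMartingale_le n i,
      fun μ hμ => CompRand.runMartingale_not_hasLebesgueDerivativeAt hz hi hμ⟩
  · push Not at h
    choose J hJ using h
    -- A coordinate equal to `1` has fractional part `0`, all of whose digits agree, so it belongs
    -- to the first case.
    have hz1 : ∀ i, z i ∈ Set.Ico (0 : ℝ) 1 := fun i => by
      refine ⟨(hz i).1, lt_of_le_of_ne (hz i).2 fun h1 => ?_⟩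
      obtain ⟨k, -, -, hk⟩ := hJ i (J i) le_rfl
      simp [h1, CompRand.bit] at hk
    have hf : ∀ i, Int.fract (z i) = z i := fun i => Int.fract_eq_self.2 (hz1 i)
    unfold CompRand.IsComputablyRandom CompRand.IsComputablyRandomSeq at hzr
    push Not at hzr
    obtain ⟨d, hd, hdc, hs⟩ := hzr
    obtain ⟨M, hM, hc, h1, hl, hu, hA, hB⟩ :=
      CompRand.exists_oscillating_martingale (NeZero.pos n) hd hdc hs
    refine ⟨M, hM, hc, h1, hl, hu, fun μ hμ =>
      CompRand.oscillating_not_hasLebesgueDerivativeAt (CompRand.mem_cell_nil.2 hz1)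
        (J₀ := Finset.univ.sup J) (fun j hj i hk => ?_) hA hB hμ⟩
    obtain ⟨k, hk1, hk2, hk3⟩ := hJ i j ((Finset.le_sup (Finset.mem_univ i)).trans hj)
    rw [hf] at hk3
    exact hk3 (hk k hk1 hk2)
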